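/- Let $k$ be an algebraically closed field of characteristic zero and $G$ a finite group. Let $\mathrm{Burn}_1(G)$ be the abelian group generated by symbols $(H, Y\circlearrowright K, \beta)$, where $H\subseteq G$ is an abelian subgroup, $Y\subseteq Z_G(H)/H$ is a subgroup, $K/k$ is a finitely generated field extension of transcendence degree $d\le 1$ with a faithful action of $Y$ over $k$, and $\beta$ is a sequence of $1-d$ nontrivial characters $H\to k^\times$ generating $H^\vee=\mathrm{Hom}(H,k^\times)$; two symbols are identified if one arises from the other by conjugating $H$, $Y$ and $\beta$ by an element of $G$, together with a compatible equivariant isomorphism over $k$ of the fields (the reordering of characters, vanishing and blow-up relations of the Burnside groups $\mathrm{Burn}_n(G)$ are void for $n=1$). For a generically free regular right action of $G$ on ${\mathbb P}^1$ over $k$, put $$ [{\mathbb P}^1\righttoleftarrow G] = (1, G\circlearrowright k({\mathbb P}^1), ()) + [{\mathbb P}^1\righttoleftarrow G]^{\mathrm{pt}}, \qquad [{\mathbb P}^1\righttoleftarrow G]^{\mathrm{pt}} = \sum_{\mathfrak p} (G_{\mathfrak p}, 1\circlearrowright k, (b_{\mathfrak p})) \in \mathrm{Burn}_1(G), $$ where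 the sum is over representatives $\mathfrak p$ of the finitely many $G$-orbits of points with nontrivial stabilizer $G_{\mathfrak p}$, and $b_{\mathfrak p}$ is the character of $G_{\mathfrak p}$ on the tangent line at $\mathfrak p$. Then, for any two generically free regular actions of $G$ on ${\mathbb P}^1$, with classes $[{\mathbb P}^1\righttoleftarrow G]$ and $[{\mathbb P}^1\righttoleftarrow G]'$, the following are equivalent: (1) the actions are equivariantly birational, i.e., there is a $G$-equivariant isomorphism over $k$ between the two function fields $k({\mathbb P}^1)$; (2) $[{\mathbb P}^1\righttoleftarrow G]=[{\mathbb P}^1\righttoleftarrow G]'$ in $\mathrm{Burn}_1(G)$; (3) $[{\mathbb P}^1\righttoleftarrow G]^{\mathrm{pt}}=[{\mathbb P}^1\righttoleftarrow G]^{\prime\,\mathrm{pt}}$ in $\mathrm{Burn}_1(G)$. -/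

import Mathlib

universe u v

namespace EquivBurnside

noncomputable section

open Polynomial

/-! ### The Burnside group in dimension one -/

/-- Conjugation by `g`, as a homomorphism between two subgroups. -/
def conjHom {G : Type v} [Group G] {A B : Subgroup G} (g : G)
    (h : ∀ x, x ∈ A ↔ g * x * g⁻¹ ∈ B) : A →* B where
  toFun x := ⟨g * x * g⁻¹, (h x).1 x.2⟩
  map_one' := by ext; simp
  map_mul' x y := by ext; simp [mul_assoc]

/-- A symbol `(H, Y ↻ K, β)` of dimension `n` for the group `G` over the ground field `k`.
A subgroup `Y ⊆ Z_G(H)/H` is recorded by its preimage `YPre` in `G`, a subgroup with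
`H ≤ YPre ≤ Z_G(H)`; a faithful action of `Y = YPre/H` is an action of `YPre` with kernel `H`. -/
structure BurnSymbol (k : Type u) [Field k] (G : Type v) [Group G] (n : ℕ) where
  /-- the stabilizer -/
  H : Subgroup G
  comm : ∀ x ∈ H, ∀ y ∈ H, x * y = y * x
  /-- the preimage of `Y ⊆ Z_G(H)/H` in `Z_G(H)` -/
  YPre : Subgroup G
  le_YPre : H ≤ YPre
  YPre_le : YPre ≤ Subgroup.centralizer (H : Set G)
  /-- the function field of the stratum -/
  K : Type u
  [fieldK : Field K]
  [algebraK : Algebra k K]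
  fg : (⊤ : IntermediateField k K).FG
  /-- the left action of `Y` on `K` over `k` -/
  act : YPre →* (K ≃ₐ[k] K)
  faithful : ∀ y : YPre, act y = 1 ↔ (y : G) ∈ H
  /-- the characters of `H` in the normal bundle -/
  β : List (H →* kˣ)
  nontrivial : ∀ b ∈ β, b ≠ 1
  generate : Subgroup.closure {b | b ∈ β} = ⊤
  dim : Algebra.trdeg k K + (β.length : Cardinal) = n

attribute [instance] BurnSymbol.fieldK BurnSymbol.algebraK

/-- The reordering and conjugation relations between symbols: `s'` arises from `s` by conjugating
`H`, `Y` and the characters by some `g`, by an isomorphism of fields over `k` compatible with the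
actions, and by a permutation of the characters. -/
def BurnSymbol.Rel {k : Type u} [Field k] {G : Type v} [Group G] {n : ℕ}
    (s s' : BurnSymbol k G n) : Prop :=
  ∃ (g : G) (hH : ∀ x, x ∈ s.H ↔ g * x * g⁻¹ ∈ s'.H)
    (hY : ∀ x, x ∈ s.YPre ↔ g * x * g⁻¹ ∈ s'.YPre),
    (∃ e : s.K ≃ₐ[k] s'.K, ∀ (y : s.YPre) (x : s.K), e (s.act y x) = s'.act (conjHom g hY y) (e x)) ∧
    (s'.β.map fun b => b.comp (conjHom g hH)).Perm s.β

/-- The group `Burn₁(G)`: the abelian group generated by the symbols of dimension one, modulo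
reordering and conjugation. The vanishing and blow-up relations of the Burnside groups concern
symbols with at least two characters; there are none of these in dimension one. -/
abbrev Burn1 (k : Type u) [Field k] (G : Type v) [Group G] : Type (max (u + 1) v) :=
  FreeAbelianGroup (BurnSymbol k G 1) ⧸
    AddSubgroup.closure {x : FreeAbelianGroup (BurnSymbol k G 1) |
      ∃ s s' : BurnSymbol k G 1, s.Rel s' ∧
        x = FreeAbelianGroup.of s - FreeAbelianGroup.of s'}

/-- The class of a symbol in `Burn₁(G)`. -/
def Burn1.of {k : Type u} [Field k] {G : Type v} [Group G] (s : BurnSymbol k G 1) : Burn1 k G :=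
  QuotientAddGroup.mk (FreeAbelianGroup.of s)

/-! ### The projective line

The points of `ℙ¹` over an algebraically closed field `k` are `k ∪ {∞}`, its function field is
`k(t)`. -/

variable {k : Type u} [Field k]

/-- The standard local coordinate at a point of `ℙ¹`: `t - a` at `a`, and `1/t` at `∞`. -/
def localParam : OnePoint k → RatFunc k
  | none => (RatFunc.X)⁻¹
  | some a => RatFunc.X - RatFunc.C a

/-- The rational function `f` is regular at the point `p` of `ℙ¹` and takes the value `c` there:
`f = P(s)/Q(s)` with polynomials `P`, `Q` in the local coordinate `s` at `p`, `Q(0) ≠ 0` and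
`c = P(0)/Q(0)`. -/
def HasValue (f : RatFunc k) (p : OnePoint k) (c : k) : Prop :=
  ∃ P Q : k[X], Q.eval 0 ≠ 0 ∧ f = aeval (localParam p) P / aeval (localParam p) Q ∧
    c = P.eval 0 / Q.eval 0

lemma transcendental_localParam (p : OnePoint k) : Transcendental k (localParam p) := by
  apply RatFunc.transcendental_of_ne_C
  rintro ⟨c, hc⟩
  have key : ∀ d : k, (RatFunc.X : RatFunc k) ≠ RatFunc.C d := by
    intro d h
    have : (Polynomial.X : k[X]) = Polynomial.C d := by
      apply RatFunc.algebraMap_injective k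
      simpa using h
    exact Polynomial.X_ne_C d this
  cases p with
  | infty =>
    refine key c⁻¹ ?_
    have h : (RatFunc.X : RatFunc k)⁻¹ = RatFunc.C c := hc
    rw [map_inv₀, ← h, inv_inv]
  | coe a =>
    refine key (c + a) ?_
    have h : (RatFunc.X : RatFunc k) - RatFunc.C a = RatFunc.C c := hc
    rw [map_add, ← h]; ring

lemma aeval_localParam_ne_zero (p : OnePoint k) {Q : k[X]} (hQ : Q ≠ 0) :
    aeval (localParam p) Q ≠ 0 := fun h =>
  hQ ((transcendental_iff.1 (transcendental_localParam p)) Q h)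

lemma localParam_ne_zero (p : OnePoint k) : localParam p ≠ 0 := by
  simpa using aeval_localParam_ne_zero p (Polynomial.X_ne_zero (R := k))

lemma ne_zero_of_eval {Q : k[X]} (hQ : Q.eval 0 ≠ 0) : Q ≠ 0 := by
  rintro rfl; simp at hQ

namespace HasValue

variable {f g : RatFunc k} {p : OnePoint k} {c d : k}

lemma unique (h : HasValue f p c) (h' : HasValue f p d) : c = d := by
  obtain ⟨P, Q, hQ, hf, rfl⟩ := h
  obtain ⟨P', Q', hQ', hf', rfl⟩ := h'
  have h1 := aeval_localParam_ne_zero p (ne_zero_of_eval hQ)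
  have h2 := aeval_localParam_ne_zero p (ne_zero_of_eval hQ')
  rw [hf, div_eq_div_iff h1 h2, ← map_mul, ← map_mul, ← sub_eq_zero, ← map_sub] at hf'
  have h3 := (transcendental_iff.1 (transcendental_localParam p)) _ hf'
  have h4 := congrArg (Polynomial.eval 0) h3
  simp only [eval_sub, eval_mul, eval_zero] at h4
  rw [div_eq_div_iff hQ hQ']
  exact sub_eq_zero.1 h4

lemma const (p : OnePoint k) (c : k) : HasValue (algebraMap k (RatFunc k) c) p c :=
  ⟨Polynomial.C c, 1, by simp, by simp, by simp⟩

lemma param (p : OnePoint k) : HasValue (localParam p) p 0 :=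
  ⟨Polynomial.X, 1, by simp, by simp, by simp⟩

lemma add (h : HasValue f p c) (h' : HasValue g p d) : HasValue (f + g) p (c + d) := by
  obtain ⟨P, Q, hQ, rfl, rfl⟩ := h
  obtain ⟨P', Q', hQ', rfl, rfl⟩ := h'
  have h1 := aeval_localParam_ne_zero p (ne_zero_of_eval hQ)
  have h2 := aeval_localParam_ne_zero p (ne_zero_of_eval hQ')
  refine ⟨P * Q' + Q * P', Q * Q', by simp [hQ, hQ'], ?_, ?_⟩
  · simp only [map_add, map_mul]; exact div_add_div _ _ h1 h2
  · simp only [eval_add, eval_mul]; exact div_add_div _ _ hQ hQ'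

lemma mul (h : HasValue f p c) (h' : HasValue g p d) : HasValue (f * g) p (c * d) := by
  obtain ⟨P, Q, hQ, rfl, rfl⟩ := h
  obtain ⟨P', Q', hQ', rfl, rfl⟩ := h'
  refine ⟨P * P', Q * Q', by simp [hQ, hQ'], ?_, ?_⟩
  · simp only [map_mul]; exact div_mul_div_comm _ _ _ _
  · simp only [eval_mul]; exact div_mul_div_comm _ _ _ _

lemma smul (r : k) (h : HasValue f p c) : HasValue (r • f) p (r * c) := by
  rw [Algebra.smul_def]; exact (const p r).mul h

lemma sub (h : HasValue f p c) (h' : HasValue g p d) : HasValue (f - g) p (c - d) := by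
  have := h.add (h'.smul (-1))
  simpa [sub_eq_add_neg] using this

lemma inv (h : HasValue f p c) (hc : c ≠ 0) : HasValue f⁻¹ p c⁻¹ := by
  obtain ⟨P, Q, hQ, rfl, rfl⟩ := h
  refine ⟨Q, P, ?_, by rw [inv_div], by rw [inv_div]⟩
  intro h; simp [h] at hc

lemma exists_eq_param_mul (h : HasValue f p 0) :
    ∃ w c, HasValue w p c ∧ f = localParam p * w := by
  obtain ⟨P, Q, hQ, rfl, h0⟩ := h
  have hP : P.eval 0 = 0 := by
    rcases div_eq_zero_iff.1 h0.symm with h | h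
    · exact h
    · exact absurd h hQ
  obtain ⟨R, rfl⟩ : (Polynomial.X : k[X]) ∣ P := by
    rw [Polynomial.X_dvd_iff, Polynomial.coeff_zero_eq_eval_zero, hP]
  exact ⟨_, _, ⟨R, Q, hQ, rfl, rfl⟩, by simp [mul_div_assoc]⟩

/-- A function that vanishes to every order at `p` is zero. -/
lemma eq_zero_of_forall (h : ∀ n : ℕ, ∃ w c, HasValue w p c ∧ f = localParam p ^ n * w) :
    f = 0 := by
  obtain ⟨w, c, ⟨P, Q, hQ, rfl, -⟩, hf⟩ := h 0
  simp only [pow_zero, one_mul] at hf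
  have hP : P = 0 := by
    by_contra hP
    obtain ⟨w, c, ⟨P', Q', hQ', rfl, -⟩, hf'⟩ := h (P.natDegree + 1)
    have h1 := aeval_localParam_ne_zero p (ne_zero_of_eval hQ)
    have h2 := aeval_localParam_ne_zero p (ne_zero_of_eval hQ')
    have h3 : aeval (localParam p) (P * Q' - X ^ (P.natDegree + 1) * P' * Q) = 0 := by
      rw [hf, ← mul_div_assoc, div_eq_div_iff h1 h2] at hf'
      simp only [map_sub, map_mul, map_pow, aeval_X]
      exact sub_eq_zero.2 hf'
    have h4 := sub_eq_zero.1 ((transcendental_iff.1 (transcendental_localParam p)) _ h3)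
    have h5 : (X : k[X]) ^ (P.natDegree + 1) ∣ P * Q' := ⟨P' * Q, by rw [h4]; ring⟩
    have h6 : IsCoprime ((X : k[X]) ^ (P.natDegree + 1)) Q' := by
      apply IsCoprime.pow_left
      rw [Polynomial.prime_X.irreducible.coprime_iff_not_dvd, Polynomial.X_dvd_iff,
        Polynomial.coeff_zero_eq_eval_zero]
      exact hQ'
    have h7 := Polynomial.natDegree_le_of_dvd (h6.dvd_of_dvd_mul_right h5) hP
    simp at h7
  rw [hf, hP]; simp

end HasValue

/-- The maximal ideal `𝔪_p` of the local ring of `ℙ¹` at `p`, as a `k`-subspace of `k(t)`. -/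
def maxIdeal (p : OnePoint k) : Submodule k (RatFunc k) where
  carrier := {f | HasValue f p 0}
  add_mem' h h' := by simpa using HasValue.add h h'
  zero_mem' := by simpa using HasValue.const p 0
  smul_mem' r _ h := by simpa using HasValue.smul r h

/-! ### Actions on the projective line -/

/-- A regular right action of `G` on `ℙ¹` over `k`: a right action on the points and a left action
on the function field over `k` by pullback of functions, i.e., if `f` is regular at `p · g`
with value `c`, then `g f` is regular at `p` with value `c`. -/
structure P1Action (k : Type u) [Field k] (G : Type v) [Group G] where
  /-- the point `p · g` -/
  pt : OnePoint k → G → OnePoint k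
  pt_one : ∀ p, pt p 1 = p
  pt_mul : ∀ p g h, pt p (g * h) = pt (pt p g) h
  /-- the pullback of rational functions -/
  pull : G →* (RatFunc k ≃ₐ[k] RatFunc k)
  regular : ∀ g p f c, HasValue f (pt p g) c → HasValue (pull g f) p c

namespace P1Action

variable {G : Type v} [Group G] (a a' : P1Action k G)

/-- The stabilizer of a point. -/
def stab (p : OnePoint k) : Subgroup G where
  carrier := {g | a.pt p g = p}
  one_mem' := a.pt_one p
  mul_mem' := by
    intro g h hg hh
    simp only [Set.mem_ofPred_eq] at *
    rw [a.pt_mul, hg, hh]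
  inv_mem' := by
    intro g hg
    simp only [Set.mem_ofPred_eq] at *
    calc a.pt p g⁻¹ = a.pt (a.pt p g) g⁻¹ := by rw [hg]
      _ = p := by rw [← a.pt_mul, mul_inv_cancel, a.pt_one]

/-- The action is generically free: it is free outside of a finite set of points (that is, on a
nonempty Zariski open subset of `ℙ¹`). -/
def GenericallyFree : Prop := {p | a.stab p ≠ ⊥}.Finite

/-- Equivariant birationality: an isomorphism of the function fields over `k` which is compatible
with the actions. -/
def Birational : Prop :=
  ∃ e : RatFunc k ≃ₐ[k] RatFunc k, ∀ (g : G) (f : RatFunc k), e (a.pull g f) = a'.pull g (e f)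

/-- The equivalence relation of lying in the same orbit. -/
def orbitSetoid : Setoid (OnePoint k) where
  r p q := ∃ g, a.pt p g = q
  iseqv :=
    { refl := fun p => ⟨1, a.pt_one p⟩
      symm := by
        rintro p q ⟨g, rfl⟩
        exact ⟨g⁻¹, by rw [← a.pt_mul, mul_inv_cancel, a.pt_one]⟩
      trans := by
        rintro p q r ⟨g, rfl⟩ ⟨h, rfl⟩
        exact ⟨g * h, a.pt_mul p g h⟩ }

/-- The stabilizer of `p` acts on the tangent line at `p` through the character `b`. Equivalently,
as in the definition here, the pullback by each `h` in the stabilizer is multiplication by `b h` on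
the cotangent line `𝔪_p/𝔪_p²`, the dual of the tangent line (the transpose of the tangent map of
`x ↦ x · h`). -/
def IsTangentChar (p : OnePoint k) (b : a.stab p →* kˣ) : Prop :=
  ∀ (h : a.stab p), ∀ f ∈ maxIdeal p, a.pull h f - (b h : k) • f ∈ (maxIdeal p) ^ 2

lemma pull_hasValue {p : OnePoint k} {g : G} (hg : g ∈ a.stab p) {f : RatFunc k} {c : k}
    (h : HasValue f p c) : HasValue (a.pull g f) p c := by
  apply a.regular
  have : a.pt p g = p := hg
  rwa [this]

/-- An element of finite order that acts trivially on the cotangent line at a fixed point acts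
trivially on all rational functions (in characteristic zero). -/
lemma pull_eq_one [CharZero k] [Finite G] {p : OnePoint k} {g : G} (hg : g ∈ a.stab p)
    {w : RatFunc k} (hw : HasValue w p 1) (hgw : a.pull g (localParam p) = localParam p * w) :
    a.pull g = 1 := by
  set s := localParam p with hs
  have hs0 : s ≠ 0 := localParam_ne_zero p
  -- powers of `g` also act trivially on the cotangent line
  have hpow : ∀ i : ℕ, ∃ w, HasValue w p 1 ∧ a.pull (g ^ i) s = s * w := by
    intro i
    induction i with
    | zero => exact ⟨1, by simpa using HasValue.const p (1 : k), by simp⟩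
    | succ i ih =>
      obtain ⟨w', hw', h'⟩ := ih
      refine ⟨w * a.pull g w', ?_, ?_⟩
      · simpa using hw.mul (a.pull_hasValue hg hw')
      · rw [pow_succ', map_mul, AlgEquiv.mul_apply, h', map_mul, hgw, mul_assoc]
  choose W hW hWs using hpow
  -- an invariant local coordinate, by averaging
  set n := orderOf g with hn
  have hnpos : 0 < n := orderOf_pos g
  set V : RatFunc k := ∑ i ∈ Finset.range n, W i with hV
  set t : RatFunc k := s * V with ht
  have hVval : HasValue V p (n : k) := by
    have : ∀ m : ℕ, HasValue (∑ i ∈ Finset.range m, W i) p (m : k) := by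
      intro m
      induction m with
      | zero => simpa using HasValue.const p (0 : k)
      | succ m ih => rw [Finset.sum_range_succ]; push_cast; exact ih.add (hW m)
    exact this n
  have hn0 : (n : k) ≠ 0 := by exact_mod_cast hnpos.ne'
  have hV0 : V ≠ 0 := by
    intro h
    have h0 : HasValue V p 0 := by rw [h]; simpa using HasValue.const p (0 : k)
    exact hn0 (hVval.unique h0)
  have hVinv := hVval.inv hn0
  have htsum : t = ∑ i ∈ Finset.range n, a.pull (g ^ i) s := by
    rw [ht, hV, Finset.mul_sum]
    exact Finset.sum_congr rfl fun i _ => (hWs i).symm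
  have htinv : a.pull g t = t := by
    rw [htsum, map_sum]
    have h1 : ∀ i, a.pull g (a.pull (g ^ i) s) = a.pull (g ^ (i + 1)) s := by
      intro i; rw [pow_succ', map_mul, AlgEquiv.mul_apply]
    simp_rw [h1]
    have h2 := Finset.sum_range_succ (fun i => a.pull (g ^ i) s) n
    have h3 := Finset.sum_range_succ' (fun i => a.pull (g ^ i) s) n
    rw [h2] at h3
    have h4 : g ^ n = g ^ 0 := by rw [hn, pow_orderOf_eq_one, pow_zero]
    rw [h4] at h3
    exact (add_right_cancel h3).symm
  -- regular functions are invariant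
  have hreg : ∀ (m : ℕ) (f : RatFunc k) (c : k), HasValue f p c →
      ∃ y d, HasValue y p d ∧ a.pull g f - f = s ^ m * y := by
    intro m
    induction m with
    | zero =>
      intro f c hf
      exact ⟨_, _, (a.pull_hasValue hg hf).sub hf, by simp⟩
    | succ m ih =>
      intro f c hf
      have h0 : HasValue (f - algebraMap k (RatFunc k) c) p 0 := by
        simpa using hf.sub (HasValue.const p c)
      obtain ⟨y, d, hy, hfy⟩ := h0.exists_eq_param_mul
      obtain ⟨z, e, hz, hyz⟩ := ih (V⁻¹ * y) _ (hVinv.mul hy)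
      refine ⟨V * z, _, hVval.mul hz, ?_⟩
      have h5 : f = algebraMap k (RatFunc k) c + t * (V⁻¹ * y) := by
        rw [ht, mul_assoc, mul_inv_cancel_left₀ hV0, ← hfy]; ring
      calc a.pull g f - f = t * (a.pull g (V⁻¹ * y) - V⁻¹ * y) := by
            conv_lhs => rw [h5, map_add, map_mul (a.pull g), htinv, AlgEquiv.commutes]
            ring
        _ = s ^ (m + 1) * (V * z) := by rw [hyz, ht]; ring
  have hfix : ∀ f c, HasValue f p c → a.pull g f = f := fun f c hf =>
    sub_eq_zero.1 (HasValue.eq_zero_of_forall (p := p) fun m => hreg m f c hf)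
  have hgs : a.pull g s = s := hfix s 0 (HasValue.param p)
  have hX : a.pull g RatFunc.X = RatFunc.X := by
    cases p with
    | infty =>
      have h6 : s = (RatFunc.X)⁻¹ := rfl
      rw [h6, map_inv₀] at hgs
      exact inv_injective hgs
    | coe b =>
      have h6 : (RatFunc.X : RatFunc k) = s + algebraMap k (RatFunc k) b := by
        have : s = RatFunc.X - RatFunc.C b := rfl
        rw [this, RatFunc.algebraMap_eq_C]; ring
      rw [h6, map_add, hgs, AlgEquiv.commutes]
  ext f
  have hle : (⊤ : IntermediateField k (RatFunc k)) ≤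
      IntermediateField.fixedField (Subgroup.zpowers (a.pull g)) := by
    rw [← RatFunc.adjoin_X, IntermediateField.adjoin_simple_le_iff]
    rintro ⟨x, hx⟩
    have hx' : x ∈ MulAction.stabilizer (RatFunc k ≃ₐ[k] RatFunc k) (RatFunc.X : RatFunc k) :=
      (Subgroup.zpowers_le.2 (show a.pull g ∈ _ from hX)) hx
    exact hx'
  exact (hle (IntermediateField.mem_top (x := f))) ⟨a.pull g, Subgroup.mem_zpowers _⟩

/-- For a generically free action only the neutral element acts trivially on functions. -/
lemma GenericallyFree.pull_injective [Infinite k] {a : P1Action k G} (ha : a.GenericallyFree)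
    {g : G} (h : a.pull g = 1) : g = 1 := by
  by_contra hg
  have key : ∀ p, a.pt p g = p := by
    intro p
    have h1 : HasValue (localParam (a.pt p g)) p 0 := by
      have := a.regular g p _ _ (HasValue.param (a.pt p g))
      rwa [h] at this
    obtain ⟨P, Q, hQ, h2, h3⟩ := h1
    have hv : HasValue (localParam (a.pt p g)) p 0 := ⟨P, Q, hQ, h2, h3⟩
    generalize a.pt p g = q at hv
    by_contra hne
    cases q with
    | infty =>
      cases p with
      | infty => exact hne rfl
      | coe b =>
        have e1 : HasValue (RatFunc.X : RatFunc k) (b : OnePoint k) b := by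
          have := (HasValue.param (b : OnePoint k)).add (HasValue.const (b : OnePoint k) b)
          have e : (localParam (b : OnePoint k)) = RatFunc.X - RatFunc.C b := rfl
          rw [e, RatFunc.algebraMap_eq_C] at this
          simpa using this
        have e2 := hv.mul e1
        have e3 : localParam (OnePoint.infty : OnePoint k) * RatFunc.X = algebraMap k _ 1 := by
          have e : localParam (OnePoint.infty : OnePoint k) = (RatFunc.X)⁻¹ := rfl
          rw [e, inv_mul_cancel₀ RatFunc.X_ne_zero, map_one]
        rw [e3] at e2
        simpa using (HasValue.const _ _).unique e2
    | coe d =>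
      cases p with
      | infty =>
        have e1 := HasValue.param (OnePoint.infty : OnePoint k)
        have e3 := (hv.mul e1).add (e1.smul d)
        have e4 : localParam (d : OnePoint k) * localParam OnePoint.infty +
            d • localParam (OnePoint.infty : OnePoint k) = algebraMap k _ 1 := by
          have e : localParam (OnePoint.infty : OnePoint k) = (RatFunc.X)⁻¹ := rfl
          have e' : (localParam (d : OnePoint k)) = RatFunc.X - RatFunc.C d := rfl
          rw [e, e', Algebra.smul_def, RatFunc.algebraMap_eq_C, sub_mul,
            mul_inv_cancel₀ RatFunc.X_ne_zero]
          simp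
        rw [e4] at e3
        simpa using (HasValue.const _ _).unique e3
      | coe b =>
        have e1 := hv.sub (HasValue.param (b : OnePoint k))
        have e4 : localParam (d : OnePoint k) - localParam (b : OnePoint k) =
            algebraMap k _ (b - d) := by
          have e : (localParam (b : OnePoint k)) = RatFunc.X - RatFunc.C b := rfl
          have e' : (localParam (d : OnePoint k)) = RatFunc.X - RatFunc.C d := rfl
          rw [e, e', RatFunc.algebraMap_eq_C, map_sub]; ring
        rw [e4] at e1
        have := (HasValue.const _ _).unique e1
        simp only [sub_zero, sub_eq_zero] at this
        exact hne (by rw [this])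
  have : {p | a.stab p ≠ ⊥} = Set.univ := by
    ext p
    simp only [Set.mem_ofPred_eq, Set.mem_univ, iff_true]
    intro hb
    have : g ∈ a.stab p := key p
    rw [hb, Subgroup.mem_bot] at this
    exact hg this
  have hfin : (Set.univ : Set (OnePoint k)).Finite := this ▸ ha
  exact Set.infinite_univ hfin

/-- The stabilizer of a point acts on the tangent line through a faithful character. -/
lemma exists_isTangentChar [CharZero k] [Finite G] (ha : a.GenericallyFree) (p : OnePoint k) :
    ∃ b : a.stab p →* kˣ, a.IsTangentChar p b ∧ Function.Injective b := by
  have hs0 := localParam_ne_zero p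
  have hex : ∀ h : a.stab p, ∃ w c, HasValue w p c ∧
      a.pull h (localParam p) = localParam p * w := fun h =>
    (a.pull_hasValue h.2 (HasValue.param p)).exists_eq_param_mul
  choose W c hW hWs using hex
  let b : a.stab p →* k :=
    { toFun := c
      map_one' := by
        have h1 := hWs 1
        simp only [OneMemClass.coe_one, map_one, AlgEquiv.one_apply] at h1
        have h2 : W 1 = algebraMap k _ 1 := by
          apply mul_left_cancel₀ hs0
          rw [← h1, map_one, mul_one]
        have h3 := hW 1
        rw [h2] at h3
        exact h3.unique (HasValue.const p 1)
      map_mul' := by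
        intro x y
        have h1 := hWs (x * y)
        rw [Subgroup.coe_mul, map_mul, AlgEquiv.mul_apply, hWs y, map_mul, hWs x, mul_assoc] at h1
        have h2 := mul_left_cancel₀ hs0 h1
        have h3 := (hW x).mul (a.pull_hasValue x.2 (hW y))
        rw [h2] at h3
        exact (hW (x * y)).unique h3 }
  refine ⟨b.toHomUnits, ?_, ?_⟩
  · intro h f hf
    obtain ⟨w, d, hw, rfl⟩ := HasValue.exists_eq_param_mul (show HasValue f p 0 from hf)
    have h1 : (b.toHomUnits h : k) = c h := rfl
    have h2 : HasValue (W h * a.pull h w - c h • w) p 0 := by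
      simpa using ((hW h).mul (a.pull_hasValue h.2 hw)).sub (hw.smul (c h))
    have h3 : a.pull h (localParam p * w) - (b.toHomUnits h : k) • (localParam p * w) =
        localParam p * (W h * a.pull h w - c h • w) := by
      rw [h1, map_mul, hWs, mul_sub, mul_smul_comm, mul_assoc]
    rw [h3, pow_two]
    exact Submodule.mul_mem_mul (HasValue.param p) h2
  · rw [injective_iff_map_eq_one]
    intro h hh
    have h1 : c h = 1 := congrArg Units.val hh
    have h2 := hW h
    rw [h1] at h2
    have := ha.pull_injective (a.pull_eq_one h.2 h2 (hWs h))
    exact Subtype.ext this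

/-- The character of the stabilizer of `p` on the tangent line at `p`. -/
def tangentChar [CharZero k] [Finite G] (ha : a.GenericallyFree) (p : OnePoint k) :
    a.stab p →* kˣ :=
  (a.exists_isTangentChar ha p).choose

lemma isTangentChar_tangentChar [CharZero k] [Finite G] (ha : a.GenericallyFree)
    (p : OnePoint k) : a.IsTangentChar p (a.tangentChar ha p) :=
  (a.exists_isTangentChar ha p).choose_spec.1

lemma tangentChar_injective [CharZero k] [Finite G] (ha : a.GenericallyFree) (p : OnePoint k) :
    Function.Injective (a.tangentChar ha p) :=
  (a.exists_isTangentChar ha p).choose_spec.2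

lemma closure_singleton_eq_top {H : Type v} [Group H] [Finite H] (b : H →* kˣ)
    (hb : Function.Injective b) : Subgroup.closure {x | x ∈ [b]} = ⊤ := by
  have hcyc : IsCyclic H := isCyclic_of_injective_ringHom ((Units.coeHom k).comp b)
    (Units.val_injective.comp hb)
  obtain ⟨h0, hgen⟩ := hcyc.exists_generator
  rw [eq_top_iff]
  intro χ _
  have hprim : IsPrimitiveRoot (b h0) (orderOf h0) := by
    rw [← orderOf_injective b hb h0]; exact IsPrimitiveRoot.orderOf _
  have : NeZero (orderOf h0) := ⟨(orderOf_pos h0).ne'⟩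
  obtain ⟨i, -, hi⟩ := (hprim.map_of_injective (f := Units.coeHom k)
    Units.val_injective).eq_pow_of_pow_eq_one
    (ξ := (χ h0 : k)) (by rw [← Units.val_pow_eq_pow_val, ← map_pow, pow_orderOf_eq_one]; simp)
  have h1 : χ = b ^ i := by
    ext x
    obtain ⟨m, rfl⟩ := Subgroup.mem_zpowers_iff.1 (hgen x)
    have h2 : χ h0 = b h0 ^ i := Units.ext (by simpa using hi.symm)
    rw [map_zpow, h2, MonoidHom.pow_apply, map_zpow, ← zpow_natCast, ← zpow_natCast,
      zpow_comm]
  rw [h1]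
  have h3 : b ∈ Subgroup.closure {x | x ∈ [b]} :=
    Subgroup.subset_closure (show b ∈ [b] from List.mem_singleton.2 rfl)
  exact pow_mem h3 i

/-- The symbol `(1, G ↻ k(ℙ¹), ())` of the generic stratum. -/
def genericSymbol [CharZero k] (ha : a.GenericallyFree) : BurnSymbol k G 1 where
  H := ⊥
  comm := by simp
  YPre := ⊤
  le_YPre := bot_le
  YPre_le := by
    intro x _
    simp [Subgroup.mem_centralizer_iff]
  K := RatFunc k
  fg := ⟨{RatFunc.X}, by simpa using RatFunc.adjoin_X⟩
  act := a.pull.comp (Subgroup.subtype ⊤)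
  faithful := by
    intro y
    constructor
    · intro h; exact ha.pull_injective h
    · intro h
      have : (y : G) = 1 := h
      simp [this]
  β := []
  nontrivial := by simp
  generate := by
    rw [eq_top_iff]
    intro χ _
    have : χ = 1 := by
      ext x
      have : x = 1 := Subsingleton.elim _ _
      rw [this, map_one, map_one]
    rw [this]; exact one_mem _
  dim := by
    have : Algebra.IsAlgebraic k[X] (RatFunc k) := IsLocalization.isAlgebraic _ (nonZeroDivisors k[X])
    have h := trdeg_add_eq k k[X] (A := RatFunc k)
    rw [trdeg_eq_zero (R := k[X]) (A := RatFunc k), Polynomial.trdeg_of_isDomain] at h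
    simpa using h.symm

/-- The symbol `(H, 1 ↻ k, (b))` of a point `p` with nontrivial stabilizer `H`, where `b` is
the character of `H` on the normal space of `p`, i.e., on the tangent line. -/
def pointSymbol [CharZero k] [Finite G] (ha : a.GenericallyFree) (p : OnePoint k)
    (hp : a.stab p ≠ ⊥) : BurnSymbol k G 1 where
  H := a.stab p
  comm := by
    intro x hx y hy
    have h : (⟨x, hx⟩ : a.stab p) * ⟨y, hy⟩ = ⟨y, hy⟩ * ⟨x, hx⟩ := by
      apply a.tangentChar_injective ha p
      rw [map_mul, map_mul, mul_comm]
    exact congrArg Subtype.val h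
  YPre := a.stab p
  le_YPre := le_rfl
  YPre_le := by
    intro x hx
    rw [Subgroup.mem_centralizer_iff]
    intro y hy
    have h : (⟨y, hy⟩ : a.stab p) * ⟨x, hx⟩ = ⟨x, hx⟩ * ⟨y, hy⟩ := by
      apply a.tangentChar_injective ha p
      rw [map_mul, map_mul, mul_comm]
    exact congrArg Subtype.val h
  K := k
  fg := ⟨∅, by
    rw [eq_top_iff]
    intro x _
    exact (IntermediateField.adjoin k _).algebraMap_mem x⟩
  act := 1
  faithful := by
    intro y
    simp
  β := [a.tangentChar ha p]
  nontrivial := by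
    intro b hb h
    simp only [List.mem_singleton] at hb
    subst hb
    apply hp
    rw [Subgroup.eq_bot_iff_forall]
    intro x hx
    have : (⟨x, hx⟩ : a.stab p) = 1 := by
      apply a.tangentChar_injective ha p
      rw [h]; simp
    exact congrArg Subtype.val this
  generate := closure_singleton_eq_top _ (a.tangentChar_injective ha p)
  dim := by simp [trdeg_eq_zero]

/-- The orbits of points with nontrivial stabilizers. -/
def SpecialOrbit : Type u :=
  {o : Quotient a.orbitSetoid // a.stab (Quotient.out o) ≠ ⊥}

lemma finite_specialOrbit (ha : a.GenericallyFree) : Finite a.SpecialOrbit := by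
  have := ha.to_subtype
  exact Finite.of_injective
    (fun o : a.SpecialOrbit => (⟨Quotient.out o.1, o.2⟩ : {p | a.stab p ≠ ⊥}))
    (fun o o' h => Subtype.ext (Quotient.out_injective (congrArg Subtype.val h)))

/-- The contribution `∑ (H, 1 ↻ k, (b))` of the points with nontrivial stabilizers to the class of
the action; the sum is over the (finitely many) orbits of such points, with one representative for
each of the orbits. -/
def pointClass [CharZero k] [Finite G] (ha : a.GenericallyFree) : Burn1 k G :=
  ∑ᶠ o : a.SpecialOrbit, Burn1.of (a.pointSymbol ha (Quotient.out o.1) o.2)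

/-- The class `[ℙ¹ ↻ G]` in `Burn₁(G)`. -/
def burnClass [CharZero k] [Finite G] (ha : a.GenericallyFree) : Burn1 k G :=
  Burn1.of (a.genericSymbol ha) + a.pointClass ha

end P1Action

end

end EquivBurnside

/-! An isomorphism of function fields that commutes with `G` induces a bijection on the points of
the projective line. It respects orbits, stabilizers and tangent characters, so equivariantly
birational actions have equal point contributions (`Birational.pointClass_eq`) and equal classes.

Conversely, the relations in `Burn1` only identify symbols with symbols, so the multiplicity of a
class of symbols is a homomorphism to the integers (`Burn1.mult`). The generic symbol has no
character and a point symbol has one, so the full class determines the generic symbol and with it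
the action on the field, up to a conjugation that is absorbed into the isomorphism
(`birational_of_burnClass_eq`).

The substance is that the point contribution alone suffices. Every `g ≠ 1` fixes a point. If `b` is
the tangent character there and `A` in SL₂ represents `g`, then `b g` is a ratio of the eigenvalues
of `A`, so `tr(A)² = 2 + b g + (b g)⁻¹` (`IsTangentChar.trace_sq`). Stabilizers with their
characters are visible in the point contribution up to conjugation, and the squared trace is a class
function insensitive to signs; hence equal contributions give equal squared traces for all `g`.

It remains that squared traces determine an embedding of a finite group in PGL₂ up to conjugacy
(`ProjLift.conjugate_of_trace_sq`). This is shown on matrix entries, without the classification of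
finite subgroups. If some `h` has order at least three, it is made diagonal in both embeddings. The
traces of `g`, `gh`, `gh⁻¹` give the diagonal entries of `g` up to a common sign, and the products
`g g₀`, `g h g₀` with a fixed `g₀` give the off-diagonal entries up to a conjugation by `diag(r,
1)`. Otherwise `G` has exponent two, and every element is diagonal or antidiagonal. Finiteness
enters by excluding nontrivial parabolic elements: an element sharing one fixed point with `h`
shares both. -/

namespace EquivBurnside

noncomputable section

open Polynomial

/-! ### Finite groups of projective transformations in dimension one -/

/-- A choice of representatives in `SL₂(k)` for a faithful homomorphism `G → PGL₂(k)`. -/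
structure ProjLift (k : Type u) [Field k] (G : Type v) [Group G] where
  /-- the representatives -/
  M : G → Matrix (Fin 2) (Fin 2) k
  det_eq : ∀ g, (M g).det = 1
  mul : ∀ g h, M (g * h) = M g * M h ∨ M (g * h) = -(M g * M h)
  faithful : ∀ g, M g = 1 ∨ M g = -1 → g = 1

namespace ProjLift

section

variable {k : Type u} [Field k] {G : Type v} [Group G]

/-- Conjugacy in `PGL₂(k)` of the underlying homomorphisms. -/
def Conjugate (L L' : ProjLift k G) : Prop :=
  ∃ A : Matrix (Fin 2) (Fin 2) k, A.det ≠ 0 ∧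
    ∀ g, L'.M g * A = A * L.M g ∨ L'.M g * A = -(A * L.M g)

lemma Conjugate.trans {L L' L'' : ProjLift k G} (h : L.Conjugate L') (h' : L'.Conjugate L'') :
    L.Conjugate L'' := by
  obtain ⟨A, hA, h⟩ := h
  obtain ⟨B, hB, h'⟩ := h'
  refine ⟨B * A, by simp [hA, hB], fun g => ?_⟩
  rcases h g with h | h <;> rcases h' g with h' | h' <;>
    simp [← mul_assoc, h'] <;> simp [mul_assoc, h]

lemma Conjugate.symm {L L' : ProjLift k G} (h : L.Conjugate L') : L'.Conjugate L := by
  obtain ⟨A, hA, h⟩ := h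
  have hu : IsUnit A.det := isUnit_iff_ne_zero.2 hA
  refine ⟨A⁻¹, by simp [hA], fun g => ?_⟩
  have key : ∀ X : Matrix (Fin 2) (Fin 2) k, A⁻¹ * (X * A) * A⁻¹ = A⁻¹ * X := fun X => by
    rw [mul_assoc, mul_assoc, Matrix.mul_nonsing_inv _ hu, mul_one]
  have key' : ∀ X : Matrix (Fin 2) (Fin 2) k, A⁻¹ * (A * X) * A⁻¹ = X * A⁻¹ := fun X => by
    rw [← mul_assoc, Matrix.nonsing_inv_mul _ hu, one_mul]
  rcases h g with h | h
  · left; rw [← key, h, key']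
  · right; rw [← key, h, mul_neg, neg_mul, key', neg_neg]

/-- Conjugation of the representatives by an invertible matrix. -/
def conj (L : ProjLift k G) (A : Matrix (Fin 2) (Fin 2) k) (hA : A.det ≠ 0) :
    ProjLift k G where
  M g := A * L.M g * A⁻¹
  det_eq g := by
    rw [Matrix.det_mul, Matrix.det_mul, L.det_eq, mul_one, ← Matrix.det_mul,
      Matrix.mul_nonsing_inv _ (isUnit_iff_ne_zero.2 hA), Matrix.det_one]
  mul g h := by
    have key : A * L.M g * A⁻¹ * (A * L.M h * A⁻¹) = A * (L.M g * L.M h) * A⁻¹ := by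
      simp only [mul_assoc]
      rw [← mul_assoc A⁻¹ A, Matrix.nonsing_inv_mul _ (isUnit_iff_ne_zero.2 hA), one_mul]
    rw [key]
    rcases L.mul g h with h | h
    · left; rw [h]
    · right; rw [h, mul_neg, neg_mul]
  faithful g hg := by
    have hu : IsUnit A.det := isUnit_iff_ne_zero.2 hA
    have key : A⁻¹ * (A * L.M g * A⁻¹) * A = L.M g := by
      simp only [mul_assoc, Matrix.nonsing_inv_mul _ hu, mul_one]
      rw [← mul_assoc, Matrix.nonsing_inv_mul _ hu, one_mul]
    apply L.faithful
    rw [← key]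
    rcases hg with h | h
    · left; rw [h, mul_one, Matrix.nonsing_inv_mul _ hu]
    · right; rw [h, mul_neg, mul_one, neg_mul, Matrix.nonsing_inv_mul _ hu]

lemma conjugate_conj (L : ProjLift k G) (A : Matrix (Fin 2) (Fin 2) k) (hA : A.det ≠ 0) :
    L.Conjugate (L.conj A hA) := by
  refine ⟨A, hA, fun g => Or.inl ?_⟩
  simp [conj, mul_assoc, Matrix.nonsing_inv_mul _ (isUnit_iff_ne_zero.2 hA)]

lemma trace_conj (L : ProjLift k G) (A : Matrix (Fin 2) (Fin 2) k) (hA : A.det ≠ 0) (g : G) :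
    ((L.conj A hA).M g).trace = (L.M g).trace := by
  simp only [conj]
  rw [Matrix.trace_mul_comm, ← mul_assoc, Matrix.nonsing_inv_mul _ (isUnit_iff_ne_zero.2 hA),
    one_mul]

variable (L L' : ProjLift k G)

lemma det_entries (g : G) : L.M g 0 0 * L.M g 1 1 - L.M g 0 1 * L.M g 1 0 = 1 := by
  rw [← Matrix.det_fin_two]; exact L.det_eq g

lemma isUnit_det (g : G) : IsUnit (L.M g).det := by simp [L.det_eq g]

/-- Products of two entries do not depend on the choice of signs. -/
lemma mul_entries (g h : G) (i j m n : Fin 2) :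
    L.M (g * h) i j * L.M (g * h) m n = (L.M g * L.M h) i j * (L.M g * L.M h) m n := by
  rcases L.mul g h with h | h <;> simp [h]

lemma trace_sq_mul (g h : G) :
    (L.M (g * h)).trace ^ 2 = (L.M g * L.M h).trace ^ 2 := by
  rcases L.mul g h with h | h <;> simp [h]

/-- The square of the trace is a class function. -/
lemma trace_sq_conj (g x : G) :
    (L.M (g * x * g⁻¹)).trace ^ 2 = (L.M x).trace ^ 2 := by
  rw [L.trace_sq_mul, Matrix.trace_mul_comm, ← L.trace_sq_mul, inv_mul_cancel_left]

lemma map_one : L.M 1 = 1 ∨ L.M 1 = -1 := by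
  have h := L.mul 1 1
  rw [mul_one] at h
  have hi := Matrix.mul_nonsing_inv _ (L.isUnit_det 1)
  rcases h with h | h
  · left
    have := congrArg (· * (L.M 1)⁻¹) h
    simp only [mul_assoc, hi, mul_one] at this
    exact this.symm
  · right
    have := congrArg (· * (L.M 1)⁻¹) h
    simp only [mul_assoc, hi, mul_one, neg_mul] at this
    rw [this, neg_neg]

lemma map_pow (g : G) (n : ℕ) : L.M (g ^ n) = L.M g ^ n ∨ L.M (g ^ n) = -(L.M g ^ n) := by
  induction n with
  | zero => simpa using L.map_one
  | succ n ih =>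
    rw [pow_succ, pow_succ]
    rcases L.mul (g ^ n) g with h | h <;> rcases ih with ih | ih <;> simp [h, ih]

/-- Up to sign, the representative of `g⁻¹` is the adjugate matrix. -/
lemma map_inv (g : G) : L.M g⁻¹ = (L.M g).adjugate ∨ L.M g⁻¹ = -(L.M g).adjugate := by
  have hm : L.M g⁻¹ = L.M g⁻¹ * L.M g * (L.M g).adjugate := by
    rw [mul_assoc, Matrix.mul_adjugate, L.det_eq, one_smul, mul_one]
  have h := L.mul g⁻¹ g
  rw [inv_mul_cancel] at h
  rcases h with h | h
  · rw [← h] at hm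
    rcases L.map_one with h1 | h1 <;> rw [h1] at hm <;> simp at hm <;> tauto
  · rw [← neg_eq_iff_eq_neg] at h
    rw [← h] at hm
    rcases L.map_one with h1 | h1 <;> rw [h1] at hm <;> simp at hm <;> tauto

/-- In characteristic zero `n • N` vanishes only for `n = 0` or `N = 0`; this is what prevents a
nontrivial unipotent matrix from having finite order. -/
lemma one_add_pow_of_mul_self_eq_zero {N : Matrix (Fin 2) (Fin 2) k} (hN : N * N = 0) (n : ℕ) :
    (1 + N) ^ n = 1 + (n : k) • N := by
  induction n with
  | zero => simp
  | succ n ih =>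
    rw [pow_succ, ih, add_mul, mul_add, mul_add, smul_mul_assoc, smul_mul_assoc, hN]
    push_cast
    rw [add_smul]
    simp
    abel

/-- There are no nontrivial parabolic elements of finite order. -/
lemma eq_one_of_trace_sq [CharZero k] [Finite G] {g : G} (h : (L.M g).trace ^ 2 = 4) : g = 1 := by
  have hn := orderOf_pos g
  obtain ⟨e, he, ht⟩ : ∃ e : k, e * e = 1 ∧ (L.M g).trace = 2 * e := by
    have : ((L.M g).trace - 2) * ((L.M g).trace + 2) = 0 := by linear_combination h
    rcases mul_eq_zero.1 this with h | h
    · exact ⟨1, by ring, by linear_combination h⟩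
    · exact ⟨-1, by ring, by linear_combination h⟩
  have he0 : e ≠ 0 := by rintro rfl; simp at he
  -- After multiplication by the sign `e` the trace is two, and Cayley–Hamilton makes `N` square to
  -- zero.
  set N := e • L.M g - 1 with hN
  have hNN : N * N = 0 := by
    rw [Matrix.trace_fin_two] at ht
    have hd := L.det_entries g
    ext i j
    fin_cases i <;> fin_cases j <;>
      simp [hN, Matrix.mul_apply, Fin.sum_univ_two, Matrix.one_apply]
    · linear_combination (L.M g 0 0) * e * e * ht - e * e * hd + (2 * e * (L.M g 0 0) - 1) * he
    · linear_combination (L.M g 0 1) * e * e * ht + (2 * e * (L.M g 0 1)) * he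
    · linear_combination (L.M g 1 0) * e * e * ht + (2 * e * (L.M g 1 0)) * he
    · linear_combination (L.M g 1 1) * e * e * ht - e * e * hd + (2 * e * (L.M g 1 1) - 1) * he
  have hNdet : N.det = 0 := by
    have := congrArg Matrix.det hNN
    simpa using this
  have hpow := one_add_pow_of_mul_self_eq_zero hNN (orderOf g)
  have hM : e • L.M g = 1 + N := by rw [hN]; abel
  have hs : ∃ s : k, (s = 1 ∨ s = -1) ∧ (1 + N) ^ orderOf g = s • 1 := by
    have h1 := L.map_pow g (orderOf g)
    rw [pow_orderOf_eq_one] at h1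
    have h2 : L.M g ^ orderOf g = 1 ∨ L.M g ^ orderOf g = -1 := by
      rcases L.map_one with h0 | h0 <;> rw [h0] at h1
      · rcases h1 with h1 | h1
        · exact Or.inl h1.symm
        · right; rw [h1, neg_neg]
      · rcases h1 with h1 | h1
        · exact Or.inr h1.symm
        · left; exact (neg_injective h1).symm
    have h3 : e ^ orderOf g = 1 ∨ e ^ orderOf g = -1 := by
      rw [← mul_self_eq_one_iff, ← mul_pow, he, one_pow]
    rw [← hM, _root_.smul_pow]
    rcases h2 with h2 | h2 <;> rcases h3 with h3 | h3 <;> rw [h2, h3]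
    · exact ⟨1, by simp, rfl⟩
    · exact ⟨-1, by simp, rfl⟩
    · exact ⟨-1, by simp, by simp⟩
    · exact ⟨1, by simp, by simp⟩
  obtain ⟨s, hs1, hs⟩ := hs
  rw [hpow] at hs
  have hn0 : ((orderOf g : ℕ) : k) ≠ 0 := by exact_mod_cast hn.ne'
  -- The sign `s` is unknown, so only the off-diagonal entries and the difference of the diagonal
  -- ones are compared; `det N = 0` does the rest.
  have hN0 : N = 0 := by
    have h01 := congrFun (congrFun hs 0) 1
    have h10 := congrFun (congrFun hs 1) 0
    have h00 := congrFun (congrFun hs 0) 0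
    have h11 := congrFun (congrFun hs 1) 1
    simp [hn.ne'] at h01 h10 h00 h11
    have heq : N 0 0 = N 1 1 := mul_left_cancel₀ hn0 (by linear_combination h00 - h11)
    have h0 : N 0 0 = 0 := by
      rw [Matrix.det_fin_two, h01, ← heq] at hNdet
      simpa using hNdet
    ext i j
    fin_cases i <;> fin_cases j <;> simp [h01, h10, h0, ← heq]
  apply L.faithful
  rw [hN0, add_zero] at hM
  have : L.M g = e • 1 := by rw [← hM, smul_smul, he, one_smul]
  rw [this]
  rcases mul_self_eq_one_iff.1 he with h | h <;> simp [h]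

end

/-! ### Diagonal elements and the elements sharing their fixed points -/

section

variable {k : Type u} [Field k] {G : Type v} [Group G] (L L' : ProjLift k G)

/-- A sign kept as a scalar of square one can be carried through `linear_combination` without case
distinctions. -/
lemma exists_sign_mul (g h : G) : ∃ s : k, s * s = 1 ∧ L.M (g * h) = s • (L.M g * L.M h) := by
  rcases L.mul g h with h | h
  · exact ⟨1, by ring, by rw [h, one_smul]⟩
  · exact ⟨-1, by ring, by rw [h, neg_smul, one_smul]⟩

lemma exists_sign_inv (g : G) : ∃ s : k, s * s = 1 ∧ L.M g⁻¹ = s • (L.M g).adjugate := by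
  rcases L.map_inv g with h | h
  · exact ⟨1, by ring, by rw [h, one_smul]⟩
  · exact ⟨-1, by ring, by rw [h, neg_smul, one_smul]⟩

/-- The representative of `h` is a diagonal matrix. -/
def IsDiag (h : G) : Prop := L.M h 0 1 = 0 ∧ L.M h 1 0 = 0

variable {L L'} {h : G}

lemma IsDiag.det (hd : L.IsDiag h) : L.M h 0 0 * L.M h 1 1 = 1 := by
  have := L.det_entries h
  rw [hd.1] at this
  linear_combination this

lemma IsDiag.sq_ne_one (hd : L.IsDiag h) (hh : h ≠ 1) : L.M h 0 0 ^ 2 ≠ 1 := by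
  intro h2
  apply hh
  apply L.faithful
  have hdet := hd.det
  rcases mul_self_eq_one_iff.1 (by rw [← h2]; ring) with h0 | h0 <;> rw [h0] at hdet
  · left
    ext i j
    fin_cases i <;> fin_cases j <;> simp [h0, hd.1, hd.2]
    linear_combination hdet
  · right
    ext i j
    fin_cases i <;> fin_cases j <;> simp [h0, hd.1, hd.2]
    linear_combination -hdet

lemma IsDiag.mul_self (hd : L.IsDiag h) : L.IsDiag (h * h) := by
  obtain ⟨s, -, hs⟩ := L.exists_sign_mul h h
  simp [IsDiag, hs, Matrix.mul_apply, Fin.sum_univ_two, hd.1, hd.2]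

/-- The upper left entry of `h * h` is `x ^ 2` up to sign, where `x` is that of `h`. Order at least
three is used in this form. -/
lemma IsDiag.pow_four_ne_one (hd : L.IsDiag h) (hh : h * h ≠ 1) : L.M h 0 0 ^ 4 ≠ 1 := by
  have h1 := hd.mul_self.sq_ne_one hh
  rw [pow_two, L.mul_entries] at h1
  simp only [Matrix.mul_apply, Fin.sum_univ_two, hd.1] at h1
  intro h4
  apply h1
  linear_combination h4

/-- A group element whose fixed points include one of those of `h` commutes with `h`. -/
lemma IsDiag.commute [CharZero k] [Finite G] (hd : L.IsDiag h) {g : G}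
    (hg : L.M g 0 1 * L.M g 1 0 = 0) : g * h = h * g := by
  -- A common fixed point makes both matrices triangular in one basis, so `gh(hg)⁻¹` is unipotent up
  -- to sign, hence trivial.
  rw [← mul_inv_eq_one]
  apply L.eq_one_of_trace_sq
  obtain ⟨s₁, hs₁, e₁⟩ := L.exists_sign_mul (g * h) (h * g)⁻¹
  obtain ⟨s₂, hs₂, e₂⟩ := L.exists_sign_inv (h * g)
  obtain ⟨s₃, hs₃, e₃⟩ := L.exists_sign_mul g h
  obtain ⟨s₄, hs₄, e₄⟩ := L.exists_sign_mul h g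
  have hdet := L.det_entries g
  have hdet' := hd.det
  rw [hg, sub_zero] at hdet
  rw [e₁, e₂, e₃, e₄, Matrix.trace_fin_two]
  simp only [Matrix.adjugate_fin_two, Matrix.smul_apply, Matrix.mul_apply, Fin.sum_univ_two,
    smul_eq_mul, hd.1, hd.2]
  have hs : (s₁ * s₂ * s₃ * s₄) ^ 2 = 1 := by
    linear_combination s₂ ^ 2 * s₃ ^ 2 * s₄ ^ 2 * hs₁ + s₃ ^ 2 * s₄ ^ 2 * hs₂ + s₄ ^ 2 * hs₃ + hs₄
  have key : L.M g 0 0 * L.M h 0 0 * (L.M h 1 1 * L.M g 1 1) = 1 := by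
    linear_combination hdet + L.M g 0 0 * L.M g 1 1 * hdet'
  trans (s₁ * s₂ * s₃ * s₄) ^ 2 * (2 * (L.M g 0 0 * L.M h 0 0 * (L.M h 1 1 * L.M g 1 1)) -
    L.M g 0 1 * L.M g 1 0 * (L.M h 0 0 ^ 2 + L.M h 1 1 ^ 2)) ^ 2
  · simp
    ring
  · rw [hs, key, hg]
    norm_num

/-- Since `g` commutes with `h`, the sign-free products of a diagonal and an off-diagonal entry
agree for `gh` and `hg`. As the diagonal entries of `g` have product one, this kills both
off-diagonal entries. -/
lemma IsDiag.isDiag_of_mul_eq_zero [CharZero k] [Finite G] (hd : L.IsDiag h) (hh : h ≠ 1) {g : G}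
    (hg : L.M g 0 1 * L.M g 1 0 = 0) : L.IsDiag g := by
  have hc := hd.commute hg
  have hdet := L.det_entries g
  have hdet' := hd.det
  have h2 := hd.sq_ne_one hh
  rw [hg, sub_zero] at hdet
  have h01 := L.mul_entries g h 0 0 0 1
  rw [hc, L.mul_entries] at h01
  have h10 := L.mul_entries g h 0 0 1 0
  rw [hc, L.mul_entries] at h10
  simp only [Matrix.mul_apply, Fin.sum_univ_two, hd.1, hd.2] at h01 h10
  have h3 : (L.M h 0 0 ^ 2 - 1) ≠ 0 := sub_ne_zero.2 h2
  constructor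
  · apply (mul_eq_zero.1 (_ : (L.M h 0 0 ^ 2 - 1) * L.M g 0 1 = 0)).resolve_left h3
    linear_combination L.M g 1 1 * h01 + L.M g 0 1 * hdet' * L.M g 0 0 * L.M g 1 1 -
      (L.M h 0 0 ^ 2 - 1) * L.M g 0 1 * hdet
  · apply (mul_eq_zero.1 (_ : (L.M h 0 0 ^ 2 - 1) * L.M g 1 0 = 0)).resolve_left h3
    linear_combination -L.M g 1 1 * h10 + L.M g 1 0 * hdet' * L.M g 0 0 * L.M g 1 1 -
      (L.M h 0 0 ^ 2 - 1) * L.M g 1 0 * hdet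

lemma IsDiag.conj_entries (hd : L.IsDiag h) (g : G) : ∃ s : k, s * s = 1 ∧
    L.M (g * h * g⁻¹) 0 1 = s * (L.M g 0 0 * L.M g 0 1 * (L.M h 1 1 - L.M h 0 0)) ∧
    L.M (g * h * g⁻¹) 1 0 = s * (L.M g 1 0 * L.M g 1 1 * (L.M h 0 0 - L.M h 1 1)) := by
  obtain ⟨s₁, hs₁, e₁⟩ := L.exists_sign_mul (g * h) g⁻¹
  obtain ⟨s₂, hs₂, e₂⟩ := L.exists_sign_inv g
  obtain ⟨s₃, hs₃, e₃⟩ := L.exists_sign_mul g h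
  have hs : s₁ * s₂ * s₃ * (s₁ * s₂ * s₃) = 1 := by
    linear_combination s₂ ^ 2 * s₃ ^ 2 * hs₁ + s₃ ^ 2 * hs₂ + hs₃
  refine ⟨s₁ * s₂ * s₃, hs, ?_, ?_⟩ <;>
  · rw [e₁, e₂, e₃]
    simp [Matrix.adjugate_fin_two, Matrix.mul_apply, Fin.sum_univ_two, hd.1, hd.2]
    ring

/-- A zero on the diagonal means that `g` moves one fixed point of `h` to the other. Then `g h g⁻¹`
shares a fixed point with `h`, hence both, so `g` exchanges the two points. -/
lemma IsDiag.apply_zero_zero_eq_zero_iff [CharZero k] [Finite G] (hd : L.IsDiag h) (hh : h ≠ 1)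
    (g : G) : L.M g 0 0 = 0 ↔ L.M g 1 1 = 0 := by
  have hdet := L.det_entries g
  have hdet' := hd.det
  have h2 := hd.sq_ne_one hh
  have hne : L.M h 0 0 - L.M h 1 1 ≠ 0 := by
    intro h3
    apply h2
    linear_combination L.M h 0 0 * h3 + hdet'
  obtain ⟨s, hs, h01, h10⟩ := hd.conj_entries g
  have hs0 : s ≠ 0 := by rintro rfl; simp at hs
  constructor
  · intro h0
    have := (hd.isDiag_of_mul_eq_zero hh (g := g * h * g⁻¹) (by rw [h01, h0]; ring)).2
    rw [h10] at this
    have hc : L.M g 1 0 ≠ 0 := by intro h; rw [h0, h] at hdet; simp at hdet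
    simpa [hs0, hc, hne] using this
  · intro h0
    have := (hd.isDiag_of_mul_eq_zero hh (g := g * h * g⁻¹) (by rw [h10, h0]; ring)).1
    rw [h01] at this
    have hc : L.M g 0 1 ≠ 0 := by intro h; rw [h0, h] at hdet; simp at hdet
    have hne' : L.M h 1 1 - L.M h 0 0 ≠ 0 := fun h => hne (by linear_combination -h)
    simpa [hs0, hc, hne'] using this

lemma IsDiag.trace_sq_mul (hd : L.IsDiag h) (g : G) :
    (L.M (g * h)).trace ^ 2 = (L.M g 0 0 * L.M h 0 0 + L.M g 1 1 * L.M h 1 1) ^ 2 := by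
  rw [L.trace_sq_mul, Matrix.trace_fin_two]
  simp [Matrix.mul_apply, Fin.sum_univ_two, hd.1, hd.2]

lemma IsDiag.trace_sq_mul_inv (hd : L.IsDiag h) (g : G) :
    (L.M (g * h⁻¹)).trace ^ 2 = (L.M g 0 0 * L.M h 1 1 + L.M g 1 1 * L.M h 0 0) ^ 2 := by
  obtain ⟨s, hs, e⟩ := L.exists_sign_inv h
  rw [L.trace_sq_mul, Matrix.trace_fin_two, e]
  simp [Matrix.adjugate_fin_two, Matrix.mul_apply, Fin.sum_univ_two, hd.1, hd.2]
  linear_combination (L.M g 0 0 * L.M h 1 1 + L.M g 1 1 * L.M h 0 0) ^ 2 * hs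

/-- The traces determine the diagonal entries up to a common sign, relative to a diagonal element
of order at least three. -/
lemma IsDiag.diagonal_entries [CharZero k] (hd : L.IsDiag h) (hd' : L'.IsDiag h) (hh : h * h ≠ 1)
    (heq : L'.M h 0 0 ^ 2 = L.M h 0 0 ^ 2)
    (ht : ∀ g, (L'.M g).trace ^ 2 = (L.M g).trace ^ 2) (g : G) :
    L'.M g 0 0 ^ 2 = L.M g 0 0 ^ 2 ∧ L'.M g 1 1 ^ 2 = L.M g 1 1 ^ 2 ∧
      L'.M g 0 0 * L'.M g 1 1 = L.M g 0 0 * L.M g 1 1 := by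
  have h4 := hd.pow_four_ne_one hh
  have h0 := ht g
  have h1 := ht (g * h)
  have h2 := ht (g * h⁻¹)
  rw [hd.trace_sq_mul, hd'.trace_sq_mul] at h1
  rw [hd.trace_sq_mul_inv, hd'.trace_sq_mul_inv] at h2
  rw [Matrix.trace_fin_two, Matrix.trace_fin_two] at h0
  have hdet := hd.det
  have hdet' := hd'.det
  have heq' : L'.M h 1 1 ^ 2 = L.M h 1 1 ^ 2 := by
    linear_combination -L.M h 1 1 ^ 2 * L'.M h 1 1 ^ 2 * heq -
      L'.M h 1 1 ^ 2 * (L.M h 0 0 * L.M h 1 1 + 1) * hdet +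
      L.M h 1 1 ^ 2 * (L'.M h 0 0 * L'.M h 1 1 + 1) * hdet'
  generalize L.M g 0 0 = a, L.M g 1 1 = d, L'.M g 0 0 = a', L'.M g 1 1 = d',
    L.M h 0 0 = x, L.M h 1 1 = y, L'.M h 0 0 = x', L'.M h 1 1 = y' at *
  -- The three traces become linear equations in the differences of `a²`, `d²` and `2ad`. With `x y
  -- = 1` the determinant of the system is `(x² - y²)(x - y)²`, nonzero because `x⁴ ≠ 1`.
  have e0 : (a' ^ 2 - a ^ 2) + (d' ^ 2 - d ^ 2) + 2 * (a' * d' - a * d) = 0 := by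
    linear_combination h0
  have e1 : (a' ^ 2 - a ^ 2) * x ^ 2 + (d' ^ 2 - d ^ 2) * y ^ 2 + 2 * (a' * d' - a * d) = 0 := by
    linear_combination h1 - a' ^ 2 * heq - d' ^ 2 * heq' - 2 * a' * d' * hdet' +
      2 * a * d * hdet
  have e2 : (a' ^ 2 - a ^ 2) * y ^ 2 + (d' ^ 2 - d ^ 2) * x ^ 2 + 2 * (a' * d' - a * d) = 0 := by
    linear_combination h2 - d' ^ 2 * heq - a' ^ 2 * heq' - 2 * a' * d' * hdet' +
      2 * a * d * hdet
  have hx4 : x ^ 4 - 1 ≠ 0 := sub_ne_zero.2 h4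
  have hx2 : x ^ 2 - 1 ≠ 0 := fun h => hx4 (by linear_combination (x ^ 2 + 1) * h)
  have hAD : (a' ^ 2 - a ^ 2) - (d' ^ 2 - d ^ 2) = 0 := by
    apply (mul_eq_zero.1 (_ : (x ^ 4 - 1) * _ = 0)).resolve_left hx4
    linear_combination x ^ 2 * (e1 - e2) +
      ((a' ^ 2 - a ^ 2) - (d' ^ 2 - d ^ 2)) * (x * y + 1) * hdet
  have hA : a' ^ 2 - a ^ 2 = 0 := by
    apply (mul_eq_zero.1 (_ : (x ^ 2 - 1) ^ 2 * _ = 0)).resolve_left (pow_ne_zero 2 hx2)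
    linear_combination x ^ 2 * (e1 - e0) + (x ^ 2 * y ^ 2 - x ^ 2) * hAD -
      (a' ^ 2 - a ^ 2) * (x * y + 1) * hdet
  have hD : d' ^ 2 - d ^ 2 = 0 := by linear_combination hA - hAD
  exact ⟨sub_eq_zero.1 hA, sub_eq_zero.1 hD, by linear_combination (e0 - hA - hD) / 2⟩

end

/-! ### Conjugacy when some element has order at least three -/

section

variable {k : Type u} [Field k] {G : Type v} [Group G] {L L' : ProjLift k G} {h : G}

/-- The product relation excludes opposite signs unless one of the two numbers is zero, and then its
sign is free. -/
lemma exists_common_sign {x y x' y' : k} (hx : x' ^ 2 = x ^ 2) (hy : y' ^ 2 = y ^ 2)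
    (hxy : x' * y' = x * y) : ∃ s : k, s * s = 1 ∧ x' = s * x ∧ y' = s * y := by
  rcases sq_eq_sq_iff_eq_or_eq_neg.1 hx with h1 | h1 <;>
  rcases sq_eq_sq_iff_eq_or_eq_neg.1 hy with h2 | h2
  · exact ⟨1, by ring, by simp [h1], by simp [h2]⟩
  · by_cases h0 : x = 0
    · exact ⟨-1, by ring, by simp [h1, h0], by simp [h2]⟩
    · refine ⟨1, by ring, by simp [h1], ?_⟩
      rw [h1] at hxy
      rw [one_mul, mul_left_cancel₀ h0 hxy]
  · by_cases h0 : x = 0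
    · exact ⟨1, by ring, by simp [h1, h0], by simp [h2]⟩
    · refine ⟨-1, by ring, by simp [h1], ?_⟩
      rw [h1] at hxy
      have := mul_left_cancel₀ h0 (by linear_combination -hxy : x * y' = x * (-y))
      rw [this]; ring
  · exact ⟨-1, by ring, by simp [h1], by simp [h2]⟩

/-- The conjugating matrix is `diag(r, 1)`: once a common diagonal element is fixed, diagonal
matrices modulo scalars are the natural remaining freedom. -/
lemma conjugate_of_entries {r : k} (hr : r ≠ 0)
    (H : ∀ g, ∃ s : k, s * s = 1 ∧ L'.M g 0 0 = s * L.M g 0 0 ∧ L'.M g 1 1 = s * L.M g 1 1 ∧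
      L'.M g 0 1 = s * r * L.M g 0 1 ∧ r * L'.M g 1 0 = s * L.M g 1 0) : L.Conjugate L' := by
  refine ⟨!![r, 0; 0, 1], by simpa [Matrix.det_fin_two] using hr, fun g => ?_⟩
  obtain ⟨s, hs, h00, h11, h01, h10⟩ := H g
  rcases mul_self_eq_one_iff.1 hs with rfl | rfl
  · left
    ext i j
    fin_cases i <;> fin_cases j <;>
      simp only [Matrix.mul_apply, Fin.sum_univ_two] <;> simp [h00, h11, h01]
    · ring
    · linear_combination h10
  · right
    ext i j
    fin_cases i <;> fin_cases j <;>
      simp only [Matrix.neg_apply, Matrix.mul_apply, Fin.sum_univ_two] <;> simp [h00, h11, h01]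
    · ring
    · linear_combination h10

/-- Conjugacy for groups that preserve the pair of coordinate points. -/
lemma conjugate_of_diag_or_antidiag
    (H : ∀ g, (L.IsDiag g ∧ L'.IsDiag g ∧
        ∃ s : k, s * s = 1 ∧ L'.M g 0 0 = s * L.M g 0 0 ∧ L'.M g 1 1 = s * L.M g 1 1) ∨
      (L.M g 0 0 = 0 ∧ L.M g 1 1 = 0 ∧ L'.M g 0 0 = 0 ∧ L'.M g 1 1 = 0)) :
    L.Conjugate L' := by
  by_cases hex : ∃ g₀, L.M g₀ 0 0 = 0 ∧ L.M g₀ 1 1 = 0 ∧ L'.M g₀ 0 0 = 0 ∧ L'.M g₀ 1 1 = 0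
  · obtain ⟨g₀, ha, hd, ha', hd'⟩ := hex
    have hdet := L.det_entries g₀
    have hdet' := L'.det_entries g₀
    rw [ha] at hdet
    rw [ha'] at hdet'
    have hb : L.M g₀ 0 1 ≠ 0 := by intro h; simp [h] at hdet
    have hb' : L'.M g₀ 0 1 ≠ 0 := by intro h; simp [h] at hdet'
    -- The ratio is chosen so that the two representatives of `g₀` match.
    refine conjugate_of_entries (div_ne_zero hb' hb) fun g => ?_
    rcases H g with ⟨h1, h2, s, hs, h00, h11⟩ | ⟨h1, h2, h1', h2'⟩
    · exact ⟨s, hs, h00, h11, by simp [h1.1, h2.1], by simp [h1.2, h2.2]⟩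
    -- An antidiagonal `g` is the product of `g g₀⁻¹`, which must be diagonal, and `g₀`; so the
    -- scalar found for `g₀` serves `g` too.
    · obtain ⟨t, ht, e⟩ := L.exists_sign_mul (g * g₀⁻¹) g₀
      obtain ⟨t', ht', e'⟩ := L'.exists_sign_mul (g * g₀⁻¹) g₀
      rw [inv_mul_cancel_right] at e e'
      have e01 := congrFun (congrFun e 0) 1
      have e10 := congrFun (congrFun e 1) 0
      have e01' := congrFun (congrFun e' 0) 1
      have e10' := congrFun (congrFun e' 1) 0
      simp [Matrix.mul_apply, Fin.sum_univ_two, ha, hd, ha', hd'] at e01 e10 e01' e10'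
      rcases H (g * g₀⁻¹) with ⟨h3, h4, s, hs, h00, h11⟩ | ⟨h3, -, -, -⟩
      · refine ⟨t * t' * s, ?_, by simp [h1, h1'], by simp [h2, h2'], ?_, ?_⟩
        · linear_combination t' ^ 2 * s ^ 2 * ht + s ^ 2 * ht' + hs
        · rw [e01, e01', h00]
          field_simp
          linear_combination (-t' * s * L.M (g * g₀⁻¹) 0 0) * ht
        · rw [e10, e10', h11]
          field_simp
          linear_combination (-t' * s * L.M (g * g₀⁻¹) 1 1 * L.M g₀ 0 1 * L.M g₀ 1 0) * ht +
            (-t' * s * L.M (g * g₀⁻¹) 1 1) * (hdet' - hdet)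
      · have hdet := L.det_entries g
        rw [h1, e01, h3] at hdet
        simp at hdet
  · refine conjugate_of_entries one_ne_zero fun g => ?_
    rcases H g with ⟨h1, h2, s, hs, h00, h11⟩ | h1
    · exact ⟨s, hs, h00, h11, by simp [h1.1, h2.1], by simp [h1.2, h2.2]⟩
    · exact absurd ⟨g, h1⟩ hex

/-- Inserting `h` weights the two summands of the upper left entry of `g g₀` by `x` and `x⁻¹`, which
allows them to be separated. -/
lemma IsDiag.zero_zero_sq_mul_mul (hd : L.IsDiag h) (g g₀ : G) :
    L.M (g * (h * g₀)) 0 0 ^ 2 =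
      (L.M g 0 0 * (L.M h 0 0 * L.M g₀ 0 0) + L.M g 0 1 * (L.M h 1 1 * L.M g₀ 1 0)) ^ 2 := by
  obtain ⟨s, hs, e⟩ := L.exists_sign_mul h g₀
  rw [pow_two, L.mul_entries, e]
  simp [Matrix.mul_apply, Fin.sum_univ_two, hd.1, hd.2]
  linear_combination (L.M g 0 0 * (L.M h 0 0 * L.M g₀ 0 0) +
    L.M g 0 1 * (L.M h 1 1 * L.M g₀ 1 0)) ^ 2 * hs

/-- Conjugacy of two lifts for which `h` of order at least three is the same diagonal element. -/
lemma IsDiag.conjugate [CharZero k] [Finite G] (hd : L.IsDiag h) (hd' : L'.IsDiag h)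
    (hh : h * h ≠ 1) (heq : L'.M h 0 0 ^ 2 = L.M h 0 0 ^ 2)
    (ht : ∀ g, (L'.M g).trace ^ 2 = (L.M g).trace ^ 2) : L.Conjugate L' := by
  have hh1 : h ≠ 1 := by rintro rfl; simp at hh
  have hdiag := hd.diagonal_entries hd' hh heq ht
  have hsign : ∀ g, ∃ s : k, s * s = 1 ∧ L'.M g 0 0 = s * L.M g 0 0 ∧
      L'.M g 1 1 = s * L.M g 1 1 := fun g =>
    exists_common_sign (hdiag g).1 (hdiag g).2.1 (hdiag g).2.2
  have hbc : ∀ g, L'.M g 0 1 * L'.M g 1 0 = L.M g 0 1 * L.M g 1 0 := fun g => by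
    linear_combination (hdiag g).2.2 - L'.det_entries g + L.det_entries g
  by_cases hex : ∃ g₀, L.M g₀ 0 0 ≠ 0 ∧ L.M g₀ 0 1 * L.M g₀ 1 0 ≠ 0
  · obtain ⟨g₀, ha, hb⟩ := hex
    obtain ⟨s₀, hs₀, ha', hd0'⟩ := hsign g₀
    have hbc₀ := hbc g₀
    have hb0 : L.M g₀ 0 1 ≠ 0 := left_ne_zero_of_mul hb
    have hc0 : L.M g₀ 1 0 ≠ 0 := right_ne_zero_of_mul hb
    have hb0' : L'.M g₀ 0 1 ≠ 0 := left_ne_zero_of_mul (hbc₀ ▸ hb)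
    have hs00 : s₀ ≠ 0 := by rintro rfl; simp at hs₀
    -- Forced by the required relation `b' = s₀ r b` at `g₀`, as `s₀` is its own inverse.
    set r := s₀ * L'.M g₀ 0 1 / L.M g₀ 0 1 with hr
    have hr0 : r ≠ 0 := div_ne_zero (mul_ne_zero hs00 hb0') hb0
    have hrb : L.M g₀ 0 1 * r = s₀ * L'.M g₀ 0 1 := by rw [hr]; field_simp
    have hrc : r * L'.M g₀ 1 0 = s₀ * L.M g₀ 1 0 := by
      apply mul_left_cancel₀ hb0
      linear_combination L'.M g₀ 1 0 * hrb + s₀ * hbc₀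
    refine conjugate_of_entries hr0 fun g => ?_
    have hg := hbc g
    -- compare the entries of `g * g₀` and `g * h * g₀`
    have h1 := (hdiag (g * g₀)).1
    rw [pow_two, pow_two, L.mul_entries, L'.mul_entries] at h1
    simp only [Matrix.mul_apply, Fin.sum_univ_two] at h1
    have h2 := (hdiag (g * (h * g₀))).1
    rw [hd.zero_zero_sq_mul_mul, hd'.zero_zero_sq_mul_mul] at h2
    have hdet := hd.det
    have hdet' := hd'.det
    have hsq := (hdiag h).2.1
    have hg0 := (hdiag g).1
    have hg₀0 := (hdiag g₀).1
    have hx2 := hd.sq_ne_one hh1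
    have hX2 : (L'.M g 0 0 * L'.M g₀ 0 0) ^ 2 = (L.M g 0 0 * L.M g₀ 0 0) ^ 2 := by
      rw [mul_pow, mul_pow, hg0, hg₀0]
    have hx : 1 - L.M h 1 1 ^ 2 ≠ 0 := by
      intro h3
      apply hx2
      linear_combination L.M h 0 0 ^ 2 * h3 + (L.M h 0 0 * L.M h 1 1 + 1) * hdet
    -- Put `X = a a₀` and `Y = b c₀`. Both lifts agree on `X²`, `(X + Y)²` and `(xX + yY)²` with `x
    -- y = 1`; the difference of the last two isolates `(1 - y²) Y²`, and `XY` follows.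
    have hY : (L'.M g 0 1 * L'.M g₀ 1 0) ^ 2 = (L.M g 0 1 * L.M g₀ 1 0) ^ 2 := by
      apply mul_left_cancel₀ hx
      linear_combination h1 - h2 - (1 - L.M h 0 0 ^ 2) * hX2 +
        (L'.M g 0 0 * L'.M g₀ 0 0) ^ 2 * heq + (L'.M g 0 1 * L'.M g₀ 1 0) ^ 2 * hsq +
        2 * (L'.M g 0 0 * L'.M g₀ 0 0) * (L'.M g 0 1 * L'.M g₀ 1 0) * hdet' -
        2 * (L.M g 0 0 * L.M g₀ 0 0) * (L.M g 0 1 * L.M g₀ 1 0) * hdet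
    have hXY : (L'.M g 0 0 * L'.M g₀ 0 0) * (L'.M g 0 1 * L'.M g₀ 1 0) =
        (L.M g 0 0 * L.M g₀ 0 0) * (L.M g 0 1 * L.M g₀ 1 0) := by
      linear_combination (h1 - hX2 - hY) / 2
    obtain ⟨s, hs, hga, hgd⟩ := hsign g
    have hs0 : s ≠ 0 := by rintro rfl; simp at hs
    -- If `a = 0`, then `d = 0` and `XY` carries no information, but the sign of the representative
    -- is free and `Y²` is enough. Otherwise `XY` determines `b'` with the sign `s` of the diagonal.
    by_cases ha0 : L.M g 0 0 = 0
    · have hd0 := (hd.apply_zero_zero_eq_zero_iff hh1 g).1 ha0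
      rw [ha0, mul_zero] at hga
      rw [hd0, mul_zero] at hgd
      have hbr : (L'.M g 0 1) ^ 2 = (r * L.M g 0 1) ^ 2 := by
        apply mul_left_cancel₀ (pow_ne_zero 2 hc0)
        linear_combination r ^ 2 * hY + L'.M g 0 1 ^ 2 * (-L.M g₀ 1 0 ^ 2 * hs₀ -
          (r * L'.M g₀ 1 0 + s₀ * L.M g₀ 1 0) * hrc)
      have hdg := L.det_entries g
      rw [ha0, zero_mul, zero_sub] at hdg
      have hgb : L.M g 0 1 ≠ 0 := by intro h; simp [h] at hdg
      obtain ⟨t, ht, htb, -⟩ := exists_common_sign hbr hbr (by linear_combination hbr)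
      refine ⟨t, ht, by simp [ha0, hga], by simp [hd0, hgd], by rw [htb]; ring, ?_⟩
      apply mul_left_cancel₀ hgb
      rw [htb] at hg
      linear_combination t * hg - r * L.M g 0 1 * L'.M g 1 0 * ht
    · have hb1 : L'.M g 0 1 = s * r * L.M g 0 1 := by
        apply mul_left_cancel₀ (mul_ne_zero (mul_ne_zero ha0 ha) hc0)
        rw [hga, ha'] at hXY
        linear_combination r * s * hXY -
          s ^ 2 * s₀ * L.M g 0 0 * L.M g₀ 0 0 * L'.M g 0 1 * hrc -
          L.M g 0 0 * L.M g₀ 0 0 * L'.M g 0 1 * L.M g₀ 1 0 * (s₀ ^ 2 * hs + hs₀)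
      refine ⟨s, hs, hga, hgd, hb1, ?_⟩
      by_cases hgb : L.M g 0 1 = 0
      · have h3 := hd.isDiag_of_mul_eq_zero hh1 (g := g) (by rw [hgb, zero_mul])
        have h4 := hd'.isDiag_of_mul_eq_zero hh1 (g := g) (by rw [hb1, hgb]; ring)
        rw [h3.2, h4.2, mul_zero, mul_zero]
      · apply mul_left_cancel₀ hgb
        rw [hb1] at hg
        linear_combination s * hg - r * L.M g 0 1 * L'.M g 1 0 * hs
  -- Without such a `g₀` every element fixes or exchanges the two coordinate points.
  · push Not at hex
    refine conjugate_of_diag_or_antidiag fun g => ?_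
    by_cases ha0 : L.M g 0 0 = 0
    · right
      have hd0 := (hd.apply_zero_zero_eq_zero_iff hh1 g).1 ha0
      obtain ⟨s, -, h1, h2⟩ := hsign g
      exact ⟨ha0, hd0, by simp [h1, ha0], by simp [h2, hd0]⟩
    · left
      have h0 := hex g ha0
      exact ⟨hd.isDiag_of_mul_eq_zero hh1 h0,
        hd'.isDiag_of_mul_eq_zero hh1 ((hbc g).trans h0), hsign g⟩

end

/-! ### Diagonalization, exponent two, and the conjugacy theorem -/

section

variable {k : Type u} [Field k] {G : Type v} [Group G] {L L' : ProjLift k G} {h : G}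

/-- Diagonalization of an element with distinct eigenvalues. -/
lemma exists_conj_isDiag (L : ProjLift k G) (h : G) {x y : k} (hxy : x ≠ y) (hdet : x * y = 1)
    (htr : (L.M h).trace = x + y) :
    ∃ (A : Matrix (Fin 2) (Fin 2) k) (hA : A.det ≠ 0),
      (L.conj A hA).IsDiag h ∧ (L.conj A hA).M h 0 0 = x := by
  have hd := L.det_entries h
  rw [Matrix.trace_fin_two] at htr
  -- Left eigenvectors are needed, since they are the rows of the conjugating matrix.
  have hex : ∀ z : k, (z - x) * (z - y) = 0 → ∃ v : Fin 2 → k, v ≠ 0 ∧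
      v 0 * L.M h 0 0 + v 1 * L.M h 1 0 = z * v 0 ∧
      v 0 * L.M h 0 1 + v 1 * L.M h 1 1 = z * v 1 := by
    intro z hz
    have : (L.M h - Matrix.diagonal fun _ => z).det = 0 := by
      rw [Matrix.det_fin_two]
      simp
      linear_combination hd + hz - z * htr - hdet
    obtain ⟨v, hv, hv'⟩ := Matrix.exists_vecMul_eq_zero_iff.2 this
    have h0 := congrFun hv' 0
    have h1 := congrFun hv' 1
    simp [Matrix.vecMul, dotProduct, Fin.sum_univ_two] at h0 h1
    exact ⟨v, hv, by linear_combination h0, by linear_combination h1⟩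
  obtain ⟨v, hv, hv0, hv1⟩ := hex x (by ring)
  obtain ⟨w, hw, hw0, hw1⟩ := hex y (by ring)
  have hne : ∀ u : Fin 2 → k, u ≠ 0 → u 0 = 0 → u 1 = 0 → False := fun u hu h0 h1 =>
    hu (by ext i; fin_cases i <;> simp [h0, h1])
  have hA : (!![v 0, v 1; w 0, w 1] : Matrix (Fin 2) (Fin 2) k).det ≠ 0 := by
    rw [Matrix.det_fin_two_of]
    intro h0
    have e0 : v 0 * w 0 = 0 := by
      apply (mul_eq_zero.1 (_ : (x - y) * _ = 0)).resolve_left (sub_ne_zero.2 hxy)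
      linear_combination -w 0 * hv0 + v 0 * hw0 - L.M h 1 0 * h0
    have e1 : v 1 * w 1 = 0 := by
      apply (mul_eq_zero.1 (_ : (x - y) * _ = 0)).resolve_left (sub_ne_zero.2 hxy)
      linear_combination -w 1 * hv1 + v 1 * hw1 + L.M h 0 1 * h0
    by_cases hv0 : v 0 = 0
    · have hv1 : v 1 ≠ 0 := fun h1 => hne v hv hv0 h1
      have hw1 : w 1 = 0 := (mul_eq_zero.1 e1).resolve_left hv1
      rw [hv0] at h0
      exact hne w hw (by simpa [hv1] using h0) hw1
    · have hw0 : w 0 = 0 := (mul_eq_zero.1 e0).resolve_left hv0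
      rw [hw0] at h0
      exact hne w hw hw0 (by simpa [hv0] using h0)
  have key : (L.conj _ hA).M h = !![x, 0; 0, y] := by
    have : !![v 0, v 1; w 0, w 1] * L.M h = !![x, 0; 0, y] * !![v 0, v 1; w 0, w 1] := by
      ext i j
      rw [Matrix.mul_apply, Matrix.mul_apply]
      fin_cases i <;> fin_cases j <;> simp [Fin.sum_univ_two, hv0, hv1, hw0, hw1]
    simp only [conj]
    rw [this, mul_assoc, Matrix.mul_nonsing_inv _ (isUnit_iff_ne_zero.2 hA), mul_one]
  exact ⟨_, hA, by simp [IsDiag, key], by simp [key]⟩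

lemma IsDiag.exists_sign (hd : L.IsDiag h) (hd' : L'.IsDiag h)
    (heq : L'.M h 0 0 ^ 2 = L.M h 0 0 ^ 2) :
    ∃ s : k, s * s = 1 ∧ L'.M h 0 0 = s * L.M h 0 0 ∧ L'.M h 1 1 = s * L.M h 1 1 := by
  have hdet := hd.det
  have hdet' := hd'.det
  refine exists_common_sign heq ?_ (by rw [hdet, hdet'])
  linear_combination -L.M h 1 1 ^ 2 * L'.M h 1 1 ^ 2 * heq -
      L'.M h 1 1 ^ 2 * (L.M h 0 0 * L.M h 1 1 + 1) * hdet +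
      L.M h 1 1 ^ 2 * (L'.M h 0 0 * L'.M h 1 1 + 1) * hdet'

lemma isDiag_one (L : ProjLift k G) : L.IsDiag 1 ∧ L.M 1 0 0 ^ 2 = 1 := by
  rcases L.map_one with h | h <;> simp [IsDiag, h]

lemma IsDiag.sq_eq_neg_one (hd : L.IsDiag h) (hh : h ≠ 1) (h2 : h * h = 1) :
    L.M h 0 0 ^ 2 = -1 := by
  have h4 := hd.sq_ne_one hh
  have h3 := L.isDiag_one.2
  rw [← h2, pow_two, L.mul_entries] at h3
  simp only [Matrix.mul_apply, Fin.sum_univ_two, hd.1] at h3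
  have := (mul_eq_zero.1 (by linear_combination h3 :
    (L.M h 0 0 ^ 2 - 1) * (L.M h 0 0 ^ 2 + 1) = 0)).resolve_left (sub_ne_zero.2 h4)
  linear_combination this

/-- In a group of exponent two only `1` and `h` are diagonal if `h` is, all other elements
exchange the fixed points of `h`. -/
lemma IsDiag.eq_one_or_eq_or_antidiag [CharZero k] (hd : L.IsDiag h) (hh : h ≠ 1)
    (hexp : ∀ g : G, g * g = 1) (g : G) :
    g = 1 ∨ g = h ∨ L.M g 0 0 = 0 ∧ L.M g 1 1 = 0 := by
  have hx := hd.sq_eq_neg_one hh (hexp h)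
  have hdet := hd.det
  have hx0 : L.M h 0 0 ≠ 0 := left_ne_zero_of_mul_eq_one hdet
  have hy : L.M h 1 1 = -L.M h 0 0 := by
    apply mul_left_cancel₀ hx0
    linear_combination hdet + hx
  have hcomm : g * h = h * g := by
    have h1 := hexp (g * h)
    calc g * h = g * h * (h * g * (h * g)) := by rw [hexp, mul_one]
      _ = g * (h * h) * g * h * g := by simp only [mul_assoc]
      _ = h * g := by rw [hexp, mul_one, hexp, one_mul]
  have hg := L.det_entries g
  -- Here `h` is `diag(x, -x)`, so commuting past it changes the sign of a diagonal entry times an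
  -- off-diagonal one. Such products vanish.
  have key : ∀ i : Fin 2, L.M g i i * L.M g 0 1 = 0 ∧ L.M g i i * L.M g 1 0 = 0 := by
    intro i
    have h01 := L.mul_entries g h i i 0 1
    rw [hcomm, L.mul_entries] at h01
    have h10 := L.mul_entries g h i i 1 0
    rw [hcomm, L.mul_entries] at h10
    revert i
    simp only [Fin.forall_fin_two, Matrix.mul_apply, Fin.sum_univ_two, hd.1, hd.2, hy]
    refine ⟨fun h01 h10 => ⟨?_, ?_⟩, fun h01 h10 => ⟨?_, ?_⟩⟩
    · linear_combination L.M g 0 0 * L.M g 0 1 * hx - h01 / 2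
    · linear_combination L.M g 0 0 * L.M g 1 0 * hx + h10 / 2
    · linear_combination L.M g 1 1 * L.M g 0 1 * hx + h01 / 2
    · linear_combination L.M g 1 1 * L.M g 1 0 * hx - h10 / 2
  by_cases ha : L.M g 0 0 = 0
  · right; right
    refine ⟨ha, ?_⟩
    have hb : L.M g 0 1 ≠ 0 := by intro h; simp [h, ha] at hg
    exact (mul_eq_zero.1 (key 1).1).resolve_right hb
  · have hdg : L.IsDiag g :=
      ⟨(mul_eq_zero.1 (key 0).1).resolve_left ha, (mul_eq_zero.1 (key 0).2).resolve_left ha⟩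
    by_cases hg1 : g = 1
    · exact Or.inl hg1
    · right; left
      have ha2 := hdg.sq_eq_neg_one hg1 (hexp g)
      by_contra hgh
      have hgh1 : g * h ≠ 1 := by
        intro h1
        apply hgh
        rw [← mul_one g, ← hexp h, ← mul_assoc, h1, one_mul]
      obtain ⟨s, hs, e⟩ := L.exists_sign_mul g h
      -- Diagonal involutions have upper left entry of square `-1`, so that of `gh` has square one.
      have hdgh : L.IsDiag (g * h) := by
        simp [IsDiag, e, Matrix.mul_apply, Fin.sum_univ_two, hd.1, hd.2, hdg.1, hdg.2]
      apply hdgh.sq_ne_one hgh1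
      rw [e]
      simp only [Matrix.smul_apply, smul_eq_mul, Matrix.mul_apply, Fin.sum_univ_two, hd.2]
      linear_combination L.M g 0 0 ^ 2 * L.M h 0 0 ^ 2 * hs + L.M h 0 0 ^ 2 * ha2 - hx

/-- In both lifts the diagonal elements are exactly `1` and `h`, and all others are antidiagonal; no
further traces need to be compared. -/
lemma IsDiag.conjugate_of_exponent_two [CharZero k] (hd : L.IsDiag h) (hd' : L'.IsDiag h)
    (hh : h ≠ 1) (hexp : ∀ g : G, g * g = 1) (heq : L'.M h 0 0 ^ 2 = L.M h 0 0 ^ 2) :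
    L.Conjugate L' := by
  refine conjugate_of_diag_or_antidiag fun g => ?_
  rcases hd.eq_one_or_eq_or_antidiag hh hexp g with rfl | rfl | h1
  · exact Or.inl ⟨L.isDiag_one.1, L'.isDiag_one.1,
      L.isDiag_one.1.exists_sign L'.isDiag_one.1 (by rw [L.isDiag_one.2, L'.isDiag_one.2])⟩
  · exact Or.inl ⟨hd, hd', hd.exists_sign hd' heq⟩
  rcases hd'.eq_one_or_eq_or_antidiag hh hexp g with rfl | rfl | h2
  · exact Or.inl ⟨L.isDiag_one.1, L'.isDiag_one.1,
      L.isDiag_one.1.exists_sign L'.isDiag_one.1 (by rw [L.isDiag_one.2, L'.isDiag_one.2])⟩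
  · exact Or.inl ⟨hd, hd', hd.exists_sign hd' heq⟩
  · exact Or.inr ⟨h1.1, h1.2, h2⟩

/-- Embeddings of a finite group in `PGL₂(k)` are determined up to conjugacy by the squares of the
traces of their representatives in `SL₂(k)`. -/
theorem conjugate_of_trace_sq [IsAlgClosed k] [CharZero k] [Finite G] (L L' : ProjLift k G)
    (ht : ∀ g, (L'.M g).trace ^ 2 = (L.M g).trace ^ 2) : L.Conjugate L' := by
  by_cases htriv : ∀ g : G, g = 1
  · refine ⟨1, by simp, fun g => ?_⟩
    rw [htriv g]
    rcases L.map_one with h | h <;> rcases L'.map_one with h' | h' <;> simp [h, h']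
  obtain ⟨h, hh, hcase⟩ : ∃ h : G, h ≠ 1 ∧ (h * h ≠ 1 ∨ ∀ g : G, g * g = 1) := by
    by_cases hexp : ∀ g : G, g * g = 1
    · push Not at htriv
      obtain ⟨h, hh⟩ := htriv
      exact ⟨h, hh, Or.inr hexp⟩
    · push Not at hexp
      obtain ⟨h, hh⟩ := hexp
      exact ⟨h, by rintro rfl; simp at hh, Or.inl hh⟩
  obtain ⟨x, y, hdet, htr⟩ : ∃ x y : k, x * y = 1 ∧ (L.M h).trace = x + y := by
    obtain ⟨z, hz⟩ := IsAlgClosed.exists_pow_nat_eq ((L.M h).trace ^ 2 - 4) (n := 2) (by norm_num)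
    exact ⟨((L.M h).trace + z) / 2, ((L.M h).trace - z) / 2, by linear_combination -hz / 4, by ring⟩
  have hxy : x ≠ y := by
    rintro rfl
    exact hh (L.eq_one_of_trace_sq (by rw [htr]; linear_combination 4 * hdet))
  obtain ⟨A, hA, hd, hx⟩ := L.exists_conj_isDiag h hxy hdet htr
  -- The traces of `h` may differ by a sign; the eigenvalues `-x`, `-y` are then prescribed, in the
  -- same order.
  obtain ⟨B, hB, hd', hx'⟩ : ∃ (B : Matrix (Fin 2) (Fin 2) k) (hB : B.det ≠ 0),
      (L'.conj B hB).IsDiag h ∧ (L'.conj B hB).M h 0 0 ^ 2 = x ^ 2 := by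
    rcases sq_eq_sq_iff_eq_or_eq_neg.1 (ht h) with h1 | h1
    · obtain ⟨B, hB, hd', hx'⟩ := L'.exists_conj_isDiag h hxy hdet (h1.trans htr)
      exact ⟨B, hB, hd', by rw [hx']⟩
    · obtain ⟨B, hB, hd', hx'⟩ := L'.exists_conj_isDiag h (x := -x) (y := -y) (neg_injective.ne hxy)
        (by rw [neg_mul_neg, hdet]) (by rw [h1, htr]; ring)
      exact ⟨B, hB, hd', by rw [hx', neg_sq]⟩
  refine ((L.conjugate_conj A hA).trans ?_).trans (L'.conjugate_conj B hB).symm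
  have heq : (L'.conj B hB).M h 0 0 ^ 2 = (L.conj A hA).M h 0 0 ^ 2 := by rw [hx, hx']
  rcases hcase with hh2 | hexp
  · exact hd.conjugate hd' hh2 heq fun g => by rw [trace_conj, trace_conj, ht]
  · exact hd.conjugate_of_exponent_two hd' hh hexp heq

end

end ProjLift

section

/-! ### Automorphisms of the field of rational functions -/

variable {k : Type u} [Field k]

lemma algEquiv_C (e : RatFunc k ≃ₐ[k] RatFunc k) (r : k) : e (RatFunc.C r) = RatFunc.C r := by
  rw [← RatFunc.algebraMap_eq_C, e.commutes]

lemma ratFunc_X_ne_C (r : k) : (RatFunc.X : RatFunc k) ≠ RatFunc.C r := by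
  intro h
  have : (Polynomial.X : k[X]) = Polynomial.C r := by
    apply RatFunc.algebraMap_injective k
    simpa using h
  exact Polynomial.X_ne_C r this

lemma algEquiv_ext_X {e e' : RatFunc k ≃ₐ[k] RatFunc k} (h : e RatFunc.X = e' RatFunc.X) :
    e = e' := by
  have hp : ∀ P : k[X], e (algebraMap k[X] (RatFunc k) P) = e' (algebraMap k[X] (RatFunc k) P) := by
    intro P
    rw [← RatFunc.aeval_X_left_eq_algebraMap, ← aeval_algHom_apply, ← aeval_algHom_apply, h]
  ext f
  rw [← RatFunc.num_div_denom f, map_div₀, map_div₀, hp, hp]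

lemma linear_eq_zero {c d : k} (h : RatFunc.C c * RatFunc.X + RatFunc.C d = 0) :
    c = 0 ∧ d = 0 := by
  have : Polynomial.C c * Polynomial.X + Polynomial.C d = 0 := by
    apply RatFunc.algebraMap_injective k
    simpa using h
  exact ⟨by simpa using congrArg (coeff · 1) this, by simpa using congrArg (coeff · 0) this⟩

lemma linear_ne_zero {c d : k} (h : c ≠ 0 ∨ d ≠ 0) :
    RatFunc.C c * RatFunc.X + RatFunc.C d ≠ 0 := fun h0 => by
  have := linear_eq_zero h0
  tauto

/-- The fractional linear function defined by a matrix. -/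
def moebius (A : Matrix (Fin 2) (Fin 2) k) : RatFunc k :=
  (RatFunc.C (A 0 0) * RatFunc.X + RatFunc.C (A 1 0)) /
    (RatFunc.C (A 0 1) * RatFunc.X + RatFunc.C (A 1 1))

lemma moebius_denom_ne_zero {A : Matrix (Fin 2) (Fin 2) k} (hA : A.det ≠ 0) :
    RatFunc.C (A 0 1) * RatFunc.X + RatFunc.C (A 1 1) ≠ 0 := by
  apply linear_ne_zero
  by_contra! h
  rw [Matrix.det_fin_two, h.1, h.2] at hA
  simp at hA

lemma moebius_num_ne_zero {A : Matrix (Fin 2) (Fin 2) k} (hA : A.det ≠ 0) :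
    RatFunc.C (A 0 0) * RatFunc.X + RatFunc.C (A 1 0) ≠ 0 := by
  apply linear_ne_zero
  by_contra! h
  rw [Matrix.det_fin_two, h.1, h.2] at hA
  simp at hA

lemma moebius_smul {s : k} (hs : s ≠ 0) (A : Matrix (Fin 2) (Fin 2) k) :
    moebius (s • A) = moebius A := by
  have : RatFunc.C s ≠ 0 := by simpa using hs
  simp only [moebius, Matrix.smul_apply, smul_eq_mul, map_mul, mul_assoc, ← mul_add]
  exact mul_div_mul_left _ _ this

lemma moebius_neg (A : Matrix (Fin 2) (Fin 2) k) : moebius (-A) = moebius A := by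
  rw [← moebius_smul (neg_ne_zero.2 one_ne_zero) A, neg_smul, one_smul]

lemma moebius_ne_C {A : Matrix (Fin 2) (Fin 2) k} (hA : A.det ≠ 0) (r : k) :
    moebius A ≠ RatFunc.C r := by
  intro h
  rw [moebius, div_eq_iff (moebius_denom_ne_zero hA)] at h
  have h1 : RatFunc.C (A 0 0 - r * A 0 1) * RatFunc.X + RatFunc.C (A 1 0 - r * A 1 1) = 0 := by
    simp only [map_sub, map_mul]
    linear_combination h
  have h2 := linear_eq_zero h1
  apply hA
  rw [Matrix.det_fin_two]
  linear_combination A 1 1 * h2.1 - A 0 1 * h2.2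

/-- Composition of fractional linear transformations. -/
lemma mul_apply_X {A B : Matrix (Fin 2) (Fin 2) k} (hA : A.det ≠ 0) (hB : B.det ≠ 0)
    {e e' : RatFunc k ≃ₐ[k] RatFunc k} (he : e RatFunc.X = moebius A)
    (he' : e' RatFunc.X = moebius B) : (e * e') RatFunc.X = moebius (A * B) := by
  have h1 := moebius_denom_ne_zero hA
  have h2 := moebius_denom_ne_zero (A := A * B) (by simp [hA, hB])
  have h3 : e (RatFunc.C (B 0 1) * RatFunc.X + RatFunc.C (B 1 1)) ≠ 0 :=
    (map_ne_zero e).2 (moebius_denom_ne_zero hB)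
  -- Numerator and denominator of `moebius A` are the entries of the row vector `(X, 1)` times `A`.
  -- This transpose of the usual convention makes composition of substitutions correspond to the
  -- product in the same order.
  rw [AlgEquiv.mul_apply, he', moebius, map_div₀, moebius, div_eq_div_iff h3 h2]
  have hm : moebius A * (RatFunc.C (A 0 1) * RatFunc.X + RatFunc.C (A 1 1)) =
    RatFunc.C (A 0 0) * RatFunc.X + RatFunc.C (A 1 0) := div_mul_cancel₀ _ h1
  simp only [map_add, map_mul, algEquiv_C, he, Matrix.mul_apply, Fin.sum_univ_two]
  linear_combination (RatFunc.C (B 0 0) * RatFunc.C (B 1 1) -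
    RatFunc.C (B 1 0) * RatFunc.C (B 0 1)) * hm

lemma eq_scalar_of_moebius_eq_X {A : Matrix (Fin 2) (Fin 2) k} (hA : A.det ≠ 0)
    (h : moebius A = RatFunc.X) : A 0 1 = 0 ∧ A 1 0 = 0 ∧ A 0 0 = A 1 1 := by
  rw [moebius, div_eq_iff (moebius_denom_ne_zero hA)] at h
  have : Polynomial.C (A 0 0) * Polynomial.X + Polynomial.C (A 1 0) =
      Polynomial.X * (Polynomial.C (A 0 1) * Polynomial.X + Polynomial.C (A 1 1)) := by
    apply RatFunc.algebraMap_injective k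
    simpa using h
  refine ⟨?_, ?_, ?_⟩
  · have := congrArg (coeff · (1 + 1)) this
    simp only [coeff_X_mul] at this
    simpa [coeff_C, coeff_X] using this.symm
  · simpa using congrArg (coeff · 0) this
  · have := congrArg (coeff · (0 + 1)) this
    simp only [coeff_X_mul] at this
    simpa [coeff_C, coeff_X] using this

/-- Every automorphism of `k(t)` over `k` is fractional linear. -/
lemma exists_moebius (e : RatFunc k ≃ₐ[k] RatFunc k) :
    ∃ A : Matrix (Fin 2) (Fin 2) k, A.det ≠ 0 ∧ e RatFunc.X = moebius A := by
  set f := e RatFunc.X with hf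
  have htop : IntermediateField.adjoin k {f} = ⊤ := by
    have h := IntermediateField.adjoin_map k {(RatFunc.X : RatFunc k)} (e : RatFunc k →ₐ[k] RatFunc k)
    rw [RatFunc.adjoin_X, Set.image_singleton] at h
    rw [hf]
    refine h.symm.trans ?_
    rw [eq_top_iff]
    intro x _
    exact ⟨e.symm x, trivial, by simp⟩
  -- The degree of `k(t)` over `k(f)` is the larger of the degrees of numerator and denominator; as
  -- `f` generates `k(t)`, it is one.
  have hrank := RatFunc.finrank_eq_max_natDegree f
  rw [htop, IntermediateField.finrank_top] at hrank
  have hn := exists_eq_X_add_C_of_natDegree_le_one (le_of_le_of_eq (le_max_left _ _) hrank.symm)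
  have hd := exists_eq_X_add_C_of_natDegree_le_one (le_of_le_of_eq (le_max_right _ _) hrank.symm)
  obtain ⟨a, b, hn⟩ := hn
  obtain ⟨c, d, hd⟩ := hd
  have hd0 := f.denom_ne_zero
  have hfeq : f = moebius !![a, c; b, d] := by
    rw [← RatFunc.num_div_denom f, hn, hd]
    simp [moebius]
  refine ⟨!![a, c; b, d], ?_, hfeq⟩
  intro hdet
  rw [Matrix.det_fin_two_of] at hdet
  have hconst : ∀ r : k, f ≠ RatFunc.C r := by
    intro r hr
    apply ratFunc_X_ne_C r
    apply e.injective
    rw [algEquiv_C, ← hr]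
  have hden : RatFunc.C c * RatFunc.X + RatFunc.C d ≠ 0 := by
    apply linear_ne_zero
    by_contra! h
    rw [hd, h.1, h.2] at hd0
    simp at hd0
  by_cases hc : c = 0
  · have hd1 : d ≠ 0 := by
      intro h
      rw [hd, hc, h] at hd0
      simp at hd0
    have ha : a = 0 := by simpa [hc, hd1] using hdet
    apply hconst (b / d)
    rw [hfeq]
    simp [moebius, hc, ha]
  · apply hconst (a / c)
    rw [hfeq]
    simp only [moebius]
    have hc' : RatFunc.C c ≠ 0 := by simpa using hc
    have hdet' := congrArg (RatFunc.C : k →+* RatFunc k) hdet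
    simp only [map_sub, map_mul, map_zero] at hdet'
    simp
    rw [div_eq_div_iff hden hc']
    linear_combination -hdet'

/-- Every invertible matrix defines an automorphism of `k(t)`. -/
lemma exists_algEquiv_moebius {A : Matrix (Fin 2) (Fin 2) k} (hA : A.det ≠ 0) :
    ∃ e : RatFunc k ≃ₐ[k] RatFunc k, e RatFunc.X = moebius A := by
  have ht : Transcendental k (moebius A) :=
    RatFunc.transcendental_of_ne_C _ (by rintro ⟨r, h⟩; exact moebius_ne_C hA r h)
  have htop : IntermediateField.adjoin k {moebius A} = ⊤ := by
    rw [eq_top_iff, ← RatFunc.adjoin_X, IntermediateField.adjoin_simple_le_iff]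
    set E := IntermediateField.adjoin k {moebius A}
    have hm : moebius A ∈ E := IntermediateField.mem_adjoin_simple_self k _
    have hC : ∀ r : k, RatFunc.C r ∈ E := fun r => E.algebraMap_mem r
    have hden := moebius_denom_ne_zero hA
    have hne : RatFunc.C (A 0 0) - RatFunc.C (A 0 1) * moebius A ≠ 0 := by
      intro h
      by_cases hc : A 0 1 = 0
      · rw [Matrix.det_fin_two] at hA
        rw [hc] at h hA
        simp at h
        simp [h] at hA
      · apply moebius_ne_C hA (A 0 0 / A 0 1)
        have hc' : RatFunc.C (A 0 1) ≠ 0 := by simpa using hc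
        rw [map_div₀, eq_div_iff hc']
        linear_combination -h
    -- The inverse fractional linear transformation recovers `X`, so the isomorphism from `k(X)` to
    -- `k(moebius A)` is onto `k(t)`.
    have hX : (RatFunc.X : RatFunc k) = (RatFunc.C (A 1 1) * moebius A - RatFunc.C (A 1 0)) /
        (RatFunc.C (A 0 0) - RatFunc.C (A 0 1) * moebius A) := by
      have h1 : moebius A * (RatFunc.C (A 0 1) * RatFunc.X + RatFunc.C (A 1 1)) =
        RatFunc.C (A 0 0) * RatFunc.X + RatFunc.C (A 1 0) := div_mul_cancel₀ _ hden
      rw [eq_div_iff hne]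
      linear_combination -h1
    rw [hX]
    exact div_mem (sub_mem (mul_mem (hC _) hm) (hC _)) (sub_mem (hC _) (mul_mem (hC _) hm))
  refine ⟨(RatFunc.algEquivOfTranscendental _ ht).trans
    ((IntermediateField.equivOfEq htop).trans IntermediateField.topEquiv), ?_⟩
  simp

lemma eq_one_or_neg_one_of_moebius_eq_X {A : Matrix (Fin 2) (Fin 2) k} (hA : A.det = 1)
    (h : moebius A = RatFunc.X) : A = 1 ∨ A = -1 := by
  obtain ⟨h01, h10, h00⟩ := eq_scalar_of_moebius_eq_X (by simp [hA]) h
  rw [Matrix.det_fin_two, h01, h00] at hA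
  rcases mul_self_eq_one_iff.1 (by linear_combination hA) with h1 | h1
  · left
    ext i j
    fin_cases i <;> fin_cases j <;> simp [h01, h10, h00, h1]
  · right
    ext i j
    fin_cases i <;> fin_cases j <;> simp [h01, h10, h00, h1]

lemma moebius_one : moebius (1 : Matrix (Fin 2) (Fin 2) k) = RatFunc.X := by
  simp [moebius]

/-- A matrix of determinant one is determined up to sign by its fractional linear function. -/
lemma eq_or_eq_neg_of_moebius_eq {A B : Matrix (Fin 2) (Fin 2) k} (hA : A.det = 1)
    (hB : B.det = 1) (h : moebius A = moebius B) : A = B ∨ A = -B := by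
  have hadj : B.adjugate.det = 1 := by rw [Matrix.det_adjugate, hB, one_pow]
  have hA0 : A.det ≠ 0 := by simp [hA]
  have hB0 : B.det ≠ 0 := by simp [hB]
  have hadj0 : B.adjugate.det ≠ 0 := by simp [hadj]
  obtain ⟨e, he⟩ := exists_algEquiv_moebius hB0
  obtain ⟨e', he'⟩ := exists_algEquiv_moebius hadj0
  -- Since `e` is represented by both `A` and `B`, the matrices `A * B.adjugate` and `B * B.adjugate
  -- = 1` define the same function. This reduces to the case of the identity.
  have h1 := mul_apply_X hB0 hadj0 he he'
  rw [mul_apply_X hA0 hadj0 (he.trans h.symm) he', Matrix.mul_adjugate, hB, one_smul,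
    moebius_one] at h1
  have h2 : A = A * B.adjugate * B := by
    rw [mul_assoc, Matrix.adjugate_mul, hB, one_smul, mul_one]
  rcases eq_one_or_neg_one_of_moebius_eq_X (by rw [Matrix.det_mul, hA, hadj, one_mul]) h1
    with h3 | h3 <;> rw [h3] at h2
  · left; rw [h2, one_mul]
  · right; rw [h2, neg_mul, one_mul]

end

section

variable {k : Type u} [Field k]

/-! ### The action of automorphisms of `k(t)` on the points -/

lemma localParam_coe (x : k) : localParam (x : OnePoint k) = RatFunc.X - RatFunc.C x := rfl

lemma localParam_infty : localParam (OnePoint.infty : OnePoint k) = (RatFunc.X)⁻¹ := rfl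

lemma HasValue.C (p : OnePoint k) (c : k) : HasValue (RatFunc.C c) p c := by
  rw [← RatFunc.algebraMap_eq_C]; exact HasValue.const p c

lemma HasValue.congr {f g : RatFunc k} {p : OnePoint k} {c d : k} (h : HasValue f p c)
    (hf : g = f) (hc : d = c) : HasValue g p d := by
  rwa [hf, hc]

lemma HasValue.linear_coe (x c d : k) :
    HasValue (RatFunc.C c * RatFunc.X + RatFunc.C d) (x : OnePoint k) (c * x + d) := by
  have hX : HasValue RatFunc.X (x : OnePoint k) x :=
    ((HasValue.param (x : OnePoint k)).add (HasValue.C _ x)).congr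
      (by rw [localParam_coe]; ring) (by ring)
  exact ((HasValue.C _ c).mul hX).add (HasValue.C _ d)

lemma HasValue.linear_infty (c d : k) :
    HasValue ((RatFunc.C c * RatFunc.X + RatFunc.C d) * (RatFunc.X)⁻¹)
      (OnePoint.infty : OnePoint k) c := by
  refine ((HasValue.C _ c).add ((HasValue.C _ d).mul (HasValue.param _))).congr ?_ (by ring)
  rw [localParam_infty, add_mul, mul_assoc, mul_inv_cancel₀ RatFunc.X_ne_zero, mul_one]

lemma HasValue.aeval {f : RatFunc k} {p : OnePoint k} {c : k} (h : HasValue f p c) (P : k[X]) :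
    HasValue (Polynomial.aeval f P) p (P.eval c) := by
  induction P using Polynomial.induction_on' with
  | add P Q hP hQ => simpa using hP.add hQ
  | monomial n r =>
    have hpow : ∀ n : ℕ, HasValue (f ^ n) p (c ^ n) := by
      intro n
      induction n with
      | zero => simpa using HasValue.const p (1 : k)
      | succ n ih => rw [pow_succ, pow_succ]; exact ih.mul h
    rw [aeval_monomial, eval_monomial]
    exact (HasValue.const p r).mul (hpow n)

lemma HasValue.div {f g : RatFunc k} {p : OnePoint k} {c d : k} (h : HasValue f p c)
    (h' : HasValue g p d) (hd : d ≠ 0) : HasValue (f / g) p (c / d) := by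
  rw [div_eq_mul_inv, div_eq_mul_inv]
  exact h.mul (h'.inv hd)

lemma adjoin_localParam (p : OnePoint k) : IntermediateField.adjoin k {localParam p} = ⊤ := by
  rw [eq_top_iff, ← RatFunc.adjoin_X, IntermediateField.adjoin_simple_le_iff]
  have h := IntermediateField.mem_adjoin_simple_self k (localParam p)
  cases p with
  | infty =>
    rw [localParam_infty] at h ⊢
    simpa using inv_mem h
  | coe x =>
    have h1 := add_mem h ((IntermediateField.adjoin k {localParam (x : OnePoint k)}).algebraMap_mem x)
    have hX : localParam (x : OnePoint k) + algebraMap k _ x = RatFunc.X := by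
      rw [RatFunc.algebraMap_eq_C, localParam_coe, sub_add_cancel]
    rwa [hX] at h1

/-- The local rings of the projective line are valuation rings. -/
lemma HasValue.exists_or_inv (f : RatFunc k) (p : OnePoint k) :
    (∃ c, HasValue f p c) ∨ HasValue f⁻¹ p 0 := by
  have hf : f ∈ IntermediateField.adjoin k {localParam p} := by
    rw [adjoin_localParam]; trivial
  -- Through `k(X) ≅ k(s)`, with `s` the local coordinate, `f` is a reduced fraction in `s`.
  -- Numerator and denominator cannot both vanish at zero.
  set σ := RatFunc.algEquivOfTranscendental _ (transcendental_localParam p)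
  set u := σ.symm ⟨f, hf⟩ with hu
  have h1 : f = Polynomial.aeval (localParam p) u.num / Polynomial.aeval (localParam p) u.denom := by
    rw [← RatFunc.algEquivOfTranscendental_apply _ (transcendental_localParam p)]
    simp [hu, σ]
  by_cases hQ : u.denom.eval 0 = 0
  · right
    have hP : u.num.eval 0 ≠ 0 := by
      intro hP
      obtain ⟨a, b, hab⟩ := u.isCoprime_num_denom
      have := congrArg (Polynomial.eval 0) hab
      simp [hP, hQ] at this
    exact ⟨u.denom, u.num, hP, by rw [h1, inv_div], by rw [hQ, zero_div]⟩
  · exact Or.inl ⟨_, u.num, u.denom, hQ, h1, rfl⟩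

/-- The image of `q` is the value of `e X` at `q`, or infinity if `e X` has a pole there. -/
lemma exists_hasValue_map_localParam (e : RatFunc k ≃ₐ[k] RatFunc k) (q : OnePoint k) :
    ∃ p, HasValue (e (localParam p)) q 0 := by
  rcases HasValue.exists_or_inv (e RatFunc.X) q with ⟨c, hc⟩ | h
  · refine ⟨(c : OnePoint k), (hc.sub (HasValue.C q c)).congr ?_ (by ring)⟩
    rw [localParam_coe, map_sub, algEquiv_C]
  · refine ⟨OnePoint.infty, ?_⟩
    rwa [localParam_infty, map_inv₀]

/-- Were two different coordinates sent to functions vanishing at `q`, a nonzero constant would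
vanish there: a difference of `X - x` and `X - y`, or `(X - x) X⁻¹ + x X⁻¹ = 1`. -/
lemma eq_of_hasValue_map_localParam {e : RatFunc k ≃ₐ[k] RatFunc k} {q p p' : OnePoint k}
    (h : HasValue (e (localParam p)) q 0) (h' : HasValue (e (localParam p')) q 0) : p = p' := by
  have key : ∀ x : k, HasValue (e (localParam (x : OnePoint k))) q 0 →
      ¬ HasValue (e (localParam (OnePoint.infty : OnePoint k))) q 0 := by
    intro x hx hi
    have h1 := (hx.mul hi).add ((HasValue.C q x).mul hi)
    have h2 : e (localParam (x : OnePoint k)) * e (localParam OnePoint.infty) +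
        RatFunc.C x * e (localParam OnePoint.infty) = RatFunc.C 1 := by
      rw [← algEquiv_C e x, ← map_mul, ← map_mul, ← map_add, localParam_coe, localParam_infty,
        ← add_mul, sub_add_cancel, mul_inv_cancel₀ RatFunc.X_ne_zero, map_one, map_one]
    rw [h2] at h1
    simpa using h1.unique (HasValue.C q 1)
  cases p with
  | infty =>
    cases p' with
    | infty => rfl
    | coe x => exact absurd h (key x h')
  | coe x =>
    cases p' with
    | infty => exact absurd h' (key x h)
    | coe y =>
      have h1 := h.sub h'
      have h2 : e (localParam (x : OnePoint k)) - e (localParam (y : OnePoint k)) =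
          RatFunc.C (y - x) := by
        rw [← map_sub, localParam_coe, localParam_coe, sub_sub_sub_cancel_left, ← map_sub,
          algEquiv_C]
      rw [h2] at h1
      have := h1.unique (HasValue.C q _)
      rw [sub_zero] at this
      rw [sub_eq_zero.1 this.symm]

/-- The map on points defined by an automorphism of `k(t)`, which is the pullback of functions. -/
def pointMap (e : RatFunc k ≃ₐ[k] RatFunc k) (q : OnePoint k) : OnePoint k :=
  (exists_hasValue_map_localParam e q).choose

lemma hasValue_pointMap (e : RatFunc k ≃ₐ[k] RatFunc k) (q : OnePoint k) :
    HasValue (e (localParam (pointMap e q))) q 0 :=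
  (exists_hasValue_map_localParam e q).choose_spec

lemma pointMap_eq {e : RatFunc k ≃ₐ[k] RatFunc k} {q p : OnePoint k}
    (h : HasValue (e (localParam p)) q 0) : pointMap e q = p :=
  eq_of_hasValue_map_localParam (hasValue_pointMap e q) h

lemma HasValue.map {e : RatFunc k ≃ₐ[k] RatFunc k} {q : OnePoint k} {f : RatFunc k} {c : k}
    (h : HasValue f (pointMap e q) c) : HasValue (e f) q c := by
  obtain ⟨P, Q, hQ, rfl, rfl⟩ := h
  have hs := hasValue_pointMap e q
  rw [map_div₀, ← aeval_algHom_apply, ← aeval_algHom_apply]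
  exact (hs.aeval P).div (hs.aeval Q) hQ

/-- Pullback is contravariant, so a left action on functions is a right action on points, as in
`pt_mul`. -/
lemma pointMap_mul (e e' : RatFunc k ≃ₐ[k] RatFunc k) (q : OnePoint k) :
    pointMap (e * e') q = pointMap e' (pointMap e q) :=
  pointMap_eq (HasValue.map (e := e) (hasValue_pointMap e' (pointMap e q)))

lemma pointMap_one (q : OnePoint k) : pointMap 1 q = q :=
  pointMap_eq (HasValue.param q)

lemma pointMap_inv_pointMap (e : RatFunc k ≃ₐ[k] RatFunc k) (q : OnePoint k) :
    pointMap e⁻¹ (pointMap e q) = q := by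
  rw [← pointMap_mul, mul_inv_cancel, pointMap_one]

lemma pointMap_pointMap_inv (e : RatFunc k ≃ₐ[k] RatFunc k) (q : OnePoint k) :
    pointMap e (pointMap e⁻¹ q) = q := by
  rw [← pointMap_mul, inv_mul_cancel, pointMap_one]

/-- The permutation of the points defined by an automorphism of `k(t)`. -/
def pointEquiv (e : RatFunc k ≃ₐ[k] RatFunc k) : OnePoint k ≃ OnePoint k where
  toFun := pointMap e
  invFun := pointMap e⁻¹
  left_inv := pointMap_inv_pointMap e
  right_inv := pointMap_pointMap_inv e

lemma hasValue_map_iff (e : RatFunc k ≃ₐ[k] RatFunc k) (q : OnePoint k) (f : RatFunc k) (c : k) :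
    HasValue (e f) q c ↔ HasValue f (pointMap e q) c := by
  refine ⟨fun h => ?_, HasValue.map⟩
  rw [← pointMap_inv_pointMap e q] at h
  have := h.map
  rwa [← AlgEquiv.mul_apply, inv_mul_cancel] at this

/-- As an equality of images it passes to the squares of the maximal ideals by `Submodule.map_pow`,
which is what transporting tangent characters requires. -/
lemma map_maxIdeal (e : RatFunc k ≃ₐ[k] RatFunc k) (q : OnePoint k) :
    (maxIdeal (pointMap e q)).map (e : RatFunc k →ₐ[k] RatFunc k).toLinearMap = maxIdeal q := by
  ext f
  constructor
  · rintro ⟨g, hg, rfl⟩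
    exact HasValue.map hg
  · intro hf
    refine ⟨e.symm f, ?_, by simp⟩
    rw [SetLike.mem_coe]
    refine (hasValue_map_iff e q _ 0).1 ?_
    rw [e.apply_symm_apply]
    exact hf

lemma exists_of_mem_maxIdeal_sq {p : OnePoint k} {f : RatFunc k} (hf : f ∈ maxIdeal p ^ 2) :
    ∃ w c, HasValue w p c ∧ f = localParam p ^ 2 * w := by
  rw [pow_two] at hf
  induction hf using Submodule.mul_induction_on' with
  | mem_mul_mem g hg h hh =>
    obtain ⟨w, c, hw, rfl⟩ := HasValue.exists_eq_param_mul hg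
    obtain ⟨w', c', hw', rfl⟩ := HasValue.exists_eq_param_mul hh
    exact ⟨_, _, hw.mul hw', by ring⟩
  | add g _ h _ hg hh =>
    obtain ⟨w, c, hw, rfl⟩ := hg
    obtain ⟨w', c', hw', rfl⟩ := hh
    exact ⟨_, _, hw.add hw', by ring⟩

/-! ### Fixed points, tangent characters and traces -/

namespace P1Action

variable {G : Type v} [Group G] (a a' : P1Action k G)

/-- Regularity, applied to the local coordinate at the image point, shows that the pullback
determines the action on points. -/
lemma pt_eq_pointMap (p : OnePoint k) (g : G) : a.pt p g = pointMap (a.pull g) p :=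
  (pointMap_eq (a.regular g p _ _ (HasValue.param _))).symm

lemma mem_stab_iff {p : OnePoint k} {g : G} : g ∈ a.stab p ↔ pointMap (a.pull g) p = p := by
  rw [← pt_eq_pointMap]; rfl

variable {a a'}

/-- Modulo `𝔪²` the local coordinate `s` is multiplied by `b h`; dividing by `s` turns this into a
value at `p`, which is unique and computable. -/
lemma IsTangentChar.hasValue {p : OnePoint k} {b : a.stab p →* kˣ} (hb : a.IsTangentChar p b)
    (h : a.stab p) : HasValue (a.pull h (localParam p) / localParam p) p (b h : k) := by
  obtain ⟨w, c, hw, he⟩ := exists_of_mem_maxIdeal_sq (hb h _ (HasValue.param p))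
  have hs := localParam_ne_zero p
  refine ((HasValue.C p (b h : k)).add ((HasValue.param p).mul hw)).congr ?_ (by ring)
  rw [Algebra.smul_def, RatFunc.algebraMap_eq_C] at he
  rw [div_eq_iff hs]
  linear_combination he

lemma IsTangentChar.unique {p : OnePoint k} {b b' : a.stab p →* kˣ} (hb : a.IsTangentChar p b)
    (hb' : a.IsTangentChar p b') : b = b' := by
  ext h
  exact (hb.hasValue h).unique (hb'.hasValue h)

/-- At a fixed point of `g`, the character of `g` on the tangent line is the ratio of the
eigenvalues of a matrix that represents `g`. -/
lemma IsTangentChar.trace_sq {p : OnePoint k} {b : a.stab p →* kˣ} (hb : a.IsTangentChar p b)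
    (h : a.stab p) {A : Matrix (Fin 2) (Fin 2) k} (hdet : A.det = 1)
    (hA : a.pull h RatFunc.X = moebius A) :
    A.trace ^ 2 = 2 + (b h : k) + (b h : k)⁻¹ := by
  have h1 := hb.hasValue h
  have h0 : HasValue (a.pull h (localParam p)) p 0 := a.pull_hasValue h.2 (HasValue.param p)
  have hA0 : A.det ≠ 0 := by simp [hdet]
  have hden := moebius_denom_ne_zero hA0
  have hnum := moebius_num_ne_zero hA0
  have hs := localParam_ne_zero p
  rw [Matrix.det_fin_two] at hdet
  rw [Matrix.trace_fin_two]
  cases p with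
  | infty =>
    rw [localParam_infty, map_inv₀, hA, moebius, inv_div] at h0 h1
    have hX := RatFunc.X_ne_zero (K := k)
    have hc : A 0 1 = 0 := by
      have h2 := h0.mul (HasValue.linear_infty (A 0 0) (A 1 0))
      have h3 := (HasValue.linear_infty (A 0 1) (A 1 1)).unique
        (h2.congr (by rw [← mul_assoc, div_mul_cancel₀ _ hnum]) rfl)
      simpa using h3
    rw [hc] at h1 hdet
    have hdet' : A 0 0 * A 1 1 = 1 := by linear_combination hdet
    have h2 := h1.mul (HasValue.linear_infty (A 0 0) (A 1 0))
    have h3 := (HasValue.C _ (A 1 1)).unique (h2.congr (by simp; field_simp) rfl)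
    have hb2 : (b h : k) = A 1 1 ^ 2 := by
      linear_combination -A 1 1 * h3 - (b h : k) * hdet'
    have hb3 : (b h : k)⁻¹ = A 0 0 ^ 2 := by
      rw [hb2]
      apply inv_eq_of_mul_eq_one_right
      linear_combination (A 0 0 * A 1 1 + 1) * hdet'
    rw [hb3, hb2]
    linear_combination 2 * hdet'
  | coe x =>
    rw [localParam_coe] at h0 h1 hs
    rw [map_sub, algEquiv_C, hA] at h0 h1
    have hm : moebius A * (RatFunc.C (A 0 1) * RatFunc.X + RatFunc.C (A 1 1)) =
      RatFunc.C (A 0 0) * RatFunc.X + RatFunc.C (A 1 0) := div_mul_cancel₀ _ hden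
    have hfix : A 0 0 * x + A 1 0 - x * (A 0 1 * x + A 1 1) = 0 := by
      have h2 := h0.mul (HasValue.linear_coe x (A 0 1) (A 1 1))
      have h3 := ((HasValue.linear_coe x (A 0 0) (A 1 0)).sub ((HasValue.C _ x).mul
        (HasValue.linear_coe x (A 0 1) (A 1 1)))).unique
        (h2.congr (by linear_combination -hm) rfl)
      linear_combination h3
    -- The two factors are the eigenvalues of `A`: the row vector `(x, 1)` has eigenvalue `A 0 1 * x
    -- + A 1 1`, and the trace gives the other.
    have hl : (A 0 0 - x * A 0 1) * (A 0 1 * x + A 1 1) = 1 := by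
      linear_combination hdet + A 0 1 * hfix
    have h2 := h1.mul (HasValue.linear_coe x (A 0 1) (A 1 1))
    have h3 := (HasValue.C (x : OnePoint k) (A 0 0 - x * A 0 1)).unique (h2.congr (by
      rw [div_mul_eq_mul_div, eq_div_iff hs]
      have := congrArg (RatFunc.C : k →+* RatFunc k) hfix
      simp only [map_sub, map_add, map_mul, map_zero] at this ⊢
      linear_combination -hm - this) rfl)
    have hb2 : (b h : k) = (A 0 0 - x * A 0 1) ^ 2 := by
      linear_combination -(A 0 0 - x * A 0 1) * h3 - (b h : k) * hl
    have hb3 : (b h : k)⁻¹ = (A 0 1 * x + A 1 1) ^ 2 := by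
      rw [hb2]
      apply inv_eq_of_mul_eq_one_right
      linear_combination ((A 0 0 - x * A 0 1) * (A 0 1 * x + A 1 1) + 1) * hl
    rw [hb3, hb2]
    linear_combination 2 * hl

/-- Every automorphism of the projective line has a fixed point. -/
lemma exists_mem_stab [IsAlgClosed k] [CharZero k] (a : P1Action k G) (g : G) :
    ∃ p, g ∈ a.stab p := by
  obtain ⟨A, hdet, hA⟩ := exists_moebius (a.pull g)
  have hden := moebius_denom_ne_zero hdet
  have hnum := moebius_num_ne_zero hdet
  rw [Matrix.det_fin_two] at hdet
  by_cases hc : A 0 1 = 0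
  · refine ⟨OnePoint.infty, a.mem_stab_iff.2 (pointMap_eq ?_)⟩
    rw [hc] at hdet
    have ha : A 0 0 ≠ 0 := by intro h; simp [h] at hdet
    rw [localParam_infty, map_inv₀, hA, moebius, inv_div, hc]
    refine (((HasValue.param _).mul (HasValue.C _ (A 1 1))).div
      (HasValue.linear_infty (A 0 0) (A 1 0)) ha).congr ?_ (by simp)
    have hX := RatFunc.X_ne_zero (K := k)
    rw [localParam_infty]
    simp
    field_simp
  -- The fixed point equation is quadratic in `x`, with leading coefficient `-A 0 1`; `z` is a
  -- square root of its discriminant.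
  · obtain ⟨x, hfix⟩ : ∃ x, A 0 0 * x + A 1 0 - x * (A 0 1 * x + A 1 1) = 0 := by
      obtain ⟨z, hz⟩ := IsAlgClosed.exists_pow_nat_eq
        ((A 0 0 - A 1 1) ^ 2 + 4 * A 0 1 * A 1 0) (n := 2) (by norm_num)
      refine ⟨(A 0 0 - A 1 1 + z) / (2 * A 0 1), ?_⟩
      field_simp
      linear_combination -hz
    have hl : (A 0 0 - x * A 0 1) * (A 0 1 * x + A 1 1) ≠ 0 := by
      intro h
      apply hdet
      linear_combination h - A 0 1 * hfix
    have hl0 := right_ne_zero_of_mul hl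
    refine ⟨(x : OnePoint k), a.mem_stab_iff.2 (pointMap_eq ?_)⟩
    rw [localParam_coe, map_sub, algEquiv_C, hA]
    refine (((HasValue.C _ (A 0 0 - x * A 0 1)).mul (HasValue.param _)).div
      (HasValue.linear_coe x (A 0 1) (A 1 1)) hl0).congr ?_ (by simp)
    have := congrArg (RatFunc.C : k →+* RatFunc k) hfix
    simp only [map_sub, map_add, map_mul, map_zero] at this
    rw [eq_div_iff hden, localParam_coe, sub_mul, moebius, div_mul_cancel₀ _ hden]
    simp only [map_sub, map_mul]
    linear_combination this

end P1Action

end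

section

variable {k : Type u} [Field k] {G : Type v} [Group G]

/-! ### Classes of symbols -/

lemma mem_iff_conj_inv_mem {A B : Subgroup G} {g : G} (h : ∀ x, x ∈ A ↔ g * x * g⁻¹ ∈ B) (x : G) :
    x ∈ B ↔ g⁻¹ * x * g⁻¹⁻¹ ∈ A := by
  rw [h]
  simp [mul_assoc]

lemma mem_iff_conj_mul_mem {A B D : Subgroup G} {g g' : G} (h : ∀ x, x ∈ A ↔ g * x * g⁻¹ ∈ B)
    (h' : ∀ x, x ∈ B ↔ g' * x * g'⁻¹ ∈ D) (x : G) :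
    x ∈ A ↔ g' * g * x * (g' * g)⁻¹ ∈ D := by
  rw [h, h']
  simp [mul_assoc]

lemma conjHom_conjHom_inv {A B : Subgroup G} {g : G} (h : ∀ x, x ∈ A ↔ g * x * g⁻¹ ∈ B) (x : B) :
    conjHom g h (conjHom g⁻¹ (mem_iff_conj_inv_mem h) x) = x := by
  ext; simp [conjHom, mul_assoc]

lemma conjHom_conjHom {A B D : Subgroup G} {g g' : G} (h : ∀ x, x ∈ A ↔ g * x * g⁻¹ ∈ B)
    (h' : ∀ x, x ∈ B ↔ g' * x * g'⁻¹ ∈ D) (x : A) :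
    conjHom g' h' (conjHom g h x) = conjHom (g' * g) (mem_iff_conj_mul_mem h h') x := by
  ext; simp [conjHom, mul_assoc]

/-! ### The relation between symbols is an equivalence relation -/

namespace BurnSymbol

variable {n : ℕ} {s s' s'' : BurnSymbol k G n}

lemma Rel.refl (s : BurnSymbol k G n) : s.Rel s := by
  refine ⟨1, by simp, by simp, ⟨AlgEquiv.refl, fun y x => ?_⟩, ?_⟩
  · have : conjHom (A := s.YPre) (B := s.YPre) 1 (by simp) y = y := by ext; simp [conjHom]
    simp [this]
  · have : ∀ b : s.H →* kˣ, b.comp (conjHom (A := s.H) (B := s.H) 1 (by simp)) = b := by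
      intro b
      ext x
      have : conjHom (A := s.H) (B := s.H) 1 (by simp) x = x := by ext; simp [conjHom]
      simp [this]
    simp [this]

lemma Rel.symm (h : s.Rel s') : s'.Rel s := by
  obtain ⟨g, hH, hY, ⟨e, he⟩, hβ⟩ := h
  refine ⟨g⁻¹, mem_iff_conj_inv_mem hH, mem_iff_conj_inv_mem hY, ⟨e.symm, fun y x => ?_⟩, ?_⟩
  · apply e.injective
    rw [he, conjHom_conjHom_inv, e.apply_symm_apply, e.apply_symm_apply]
  · have := (hβ.map fun b => b.comp (conjHom g⁻¹ (mem_iff_conj_inv_mem hH))).symm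
    rw [List.map_map] at this
    refine this.trans (List.Perm.of_eq ?_)
    conv_rhs => rw [← List.map_id s'.β]
    refine List.map_congr_left fun b _ => ?_
    ext x
    simp [conjHom_conjHom_inv]

lemma Rel.trans (h : s.Rel s') (h' : s'.Rel s'') : s.Rel s'' := by
  obtain ⟨g, hH, hY, ⟨e, he⟩, hβ⟩ := h
  obtain ⟨g', hH', hY', ⟨e', he'⟩, hβ'⟩ := h'
  refine ⟨g' * g, mem_iff_conj_mul_mem hH hH', mem_iff_conj_mul_mem hY hY',
    ⟨e.trans e', fun y x => ?_⟩, ?_⟩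
  · rw [AlgEquiv.trans_apply, he, he', conjHom_conjHom]
    rfl
  · refine List.Perm.trans (List.Perm.of_eq ?_)
      ((hβ'.map fun b => b.comp (conjHom g hH)).trans hβ)
    rw [List.map_map]
    refine List.map_congr_left fun b _ => ?_
    ext x
    simp [conjHom_conjHom]

end BurnSymbol

/-! ### Multiplicities of symbols -/

namespace Burn1

lemma of_eq_of_rel {s s' : BurnSymbol k G 1} (h : s.Rel s') : Burn1.of s = Burn1.of s' := by
  rw [Burn1.of, Burn1.of, QuotientAddGroup.eq_iff_sub_mem]
  exact AddSubgroup.subset_closure ⟨s, s', h, rfl⟩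

open Classical in
/-- The multiplicity of the class of a symbol. -/
def mult (s : BurnSymbol k G 1) : Burn1 k G →+ ℤ :=
  QuotientAddGroup.lift _ (FreeAbelianGroup.lift fun t => if s.Rel t then (1 : ℤ) else 0) (by
    rw [AddSubgroup.closure_le]
    rintro _ ⟨t, t', h, rfl⟩
    have : s.Rel t ↔ s.Rel t' := ⟨fun h' => h'.trans h, fun h' => h'.trans h.symm⟩
    simp [this])

open Classical in
lemma mult_of (s t : BurnSymbol k G 1) : mult s (Burn1.of t) = if s.Rel t then (1 : ℤ) else 0 := by
  simp [mult, Burn1.of]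

lemma mult_sum_eq_zero {ι : Type*} (s : BurnSymbol k G 1) (t : ι → BurnSymbol k G 1)
    (h : ∀ i, ¬ s.Rel (t i)) : mult s (∑ᶠ i, Burn1.of (t i)) = 0 := by
  classical
  by_cases hf : Function.HasFiniteSupport fun i => Burn1.of (t i)
  · rw [finsum_def, dif_pos hf, map_sum]
    exact Finset.sum_eq_zero fun i _ => by simp [mult_of, h]
  -- A sum with infinite support is zero by convention.
  · rw [finsum_def, dif_neg hf, map_zero]

/-- Symbols that contribute to a sum of symbols can be read off from the class of the sum. -/
lemma exists_rel_of_sum_eq {ι ι' : Type*} [Finite ι] (t : ι → BurnSymbol k G 1)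
    (t' : ι' → BurnSymbol k G 1) (h : ∑ᶠ i, Burn1.of (t i) = ∑ᶠ i, Burn1.of (t' i)) (i : ι) :
    ∃ j, (t i).Rel (t' j) := by
  classical
  by_contra! hno
  have h0 := mult_sum_eq_zero (t i) t' hno
  have := Fintype.ofFinite ι
  rw [← h, finsum_eq_sum_of_fintype, map_sum] at h0
  -- Multiplicities are nonnegative, so nothing cancels the contribution one of `t i` itself.
  have h1 := (Finset.sum_eq_zero_iff_of_nonneg (fun j _ => by
    rw [mult_of]; split_ifs <;> simp)).1 h0 i (Finset.mem_univ i)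
  rw [mult_of, if_pos (BurnSymbol.Rel.refl _)] at h1
  exact one_ne_zero h1

end Burn1

/-! ### Classes of actions and equivariant birationality -/

namespace P1Action

lemma pull_mul_apply (a : P1Action k G) (g h : G) (f : RatFunc k) :
    a.pull (g * h) f = a.pull g (a.pull h f) := by
  rw [map_mul, AlgEquiv.mul_apply]

variable {a a' : P1Action k G}

/-- The twist by `γ` is the conjugation permitted between symbols; it arises when `e` is corrected
by the action of a group element. -/
lemma mem_stab_iff_of_intertwine {e : RatFunc k ≃ₐ[k] RatFunc k} {γ : G}
    (he : ∀ g f, e (a.pull g f) = a'.pull (γ * g * γ⁻¹) (e f)) (q : OnePoint k) (x : G) :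
    x ∈ a.stab (pointMap e q) ↔ γ * x * γ⁻¹ ∈ a'.stab q := by
  have h : e * a.pull x = a'.pull (γ * x * γ⁻¹) * e := AlgEquiv.ext (he x)
  rw [mem_stab_iff, mem_stab_iff, ← pointMap_mul, h, pointMap_mul]
  exact (pointEquiv e).injective.eq_iff

/-- Symbols of points that correspond to each other under an isomorphism of actions. -/
lemma pointSymbol_rel [CharZero k] [Finite G] (ha : a.GenericallyFree) (ha' : a'.GenericallyFree)
    {e : RatFunc k ≃ₐ[k] RatFunc k} {γ : G}
    (he : ∀ g f, e (a.pull g f) = a'.pull (γ * g * γ⁻¹) (e f)) {p q : OnePoint k}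
    (hpq : pointMap e q = p) (hp : a.stab p ≠ ⊥) (hq : a'.stab q ≠ ⊥) :
    (a.pointSymbol ha p hp).Rel (a'.pointSymbol ha' q hq) := by
  subst hpq
  have hst := mem_stab_iff_of_intertwine he q
  refine ⟨γ, hst, hst, ⟨AlgEquiv.refl, fun y x => rfl⟩, List.Perm.of_eq ?_⟩
  refine congrArg (fun b => [b]) ?_
  -- It suffices that the conjugated character at `q` satisfies the defining congruence at `p`; `e`
  -- carries that congruence over from `q`.
  refine IsTangentChar.unique ?_ (a.isTangentChar_tangentChar ha _)
  intro h f hf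
  have h1 := a'.isTangentChar_tangentChar ha' q (conjHom γ hst h) (e f) (HasValue.map hf)
  rw [← map_maxIdeal e q, ← Submodule.map_pow] at h1
  obtain ⟨w, hw, hwe⟩ := h1
  have h2 : w = a.pull h f - ((a'.tangentChar ha' q (conjHom γ hst h) : kˣ) : k) • f := by
    apply e.injective
    rw [map_sub, he, Algebra.smul_def, map_mul e, e.commutes, ← Algebra.smul_def]
    exact hwe
  rw [h2] at hw
  exact hw

lemma Birational.pointMap_pt {e : RatFunc k ≃ₐ[k] RatFunc k}
    (he : ∀ (g : G) (f : RatFunc k), e (a.pull g f) = a'.pull g (e f)) (q : OnePoint k) (g : G) :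
    pointMap e (a'.pt q g) = a.pt (pointMap e q) g := by
  have h : e * a.pull g = a'.pull g * e := AlgEquiv.ext (he g)
  rw [pt_eq_pointMap, pt_eq_pointMap, ← pointMap_mul, ← pointMap_mul, h]

/-- Equivariant birationality preserves the contribution of the points. -/
theorem Birational.pointClass_eq [CharZero k] [Finite G] (ha : a.GenericallyFree)
    (ha' : a'.GenericallyFree) (h : a.Birational a') : a.pointClass ha = a'.pointClass ha' := by
  obtain ⟨e, he⟩ := h
  let φ : Quotient a'.orbitSetoid ≃ Quotient a.orbitSetoid :=
    Quotient.congr (pointEquiv e) (by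
      intro q q'
      change (∃ g, a'.pt q g = q') ↔ ∃ g, a.pt (pointMap e q) g = pointMap e q'
      simp only [← Birational.pointMap_pt he]
      exact exists_congr fun g => (pointEquiv e).injective.eq_iff.symm)
  -- The point map of `e` respects orbits but not their chosen representatives. Composing `e` with
  -- the action of a suitable `γ` matches them, at the price of conjugation by `γ`.
  have hex : ∀ o : Quotient a'.orbitSetoid, ∃ γ : G, ∃ e' : RatFunc k ≃ₐ[k] RatFunc k,
      (∀ g f, e' (a.pull g f) = a'.pull (γ * g * γ⁻¹) (e' f)) ∧
        pointMap e' o.out = (φ o).out := by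
    intro o
    have h1 : φ o = Quotient.mk _ (pointMap e o.out) := by
      conv_lhs => rw [← Quotient.out_eq o]
      rfl
    have h2 : (Quotient.mk a.orbitSetoid (pointMap e o.out)) = Quotient.mk _ (φ o).out := by
      rw [Quotient.out_eq, h1]
    obtain ⟨γ, hγ⟩ : ∃ γ, a.pt (pointMap e o.out) γ = (φ o).out := Quotient.exact h2
    refine ⟨γ, a'.pull γ * e, fun g f => ?_, ?_⟩
    · rw [AlgEquiv.mul_apply, AlgEquiv.mul_apply, he, ← pull_mul_apply, ← pull_mul_apply,
        inv_mul_cancel_right]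
    · rw [pointMap_mul, ← pt_eq_pointMap, Birational.pointMap_pt he, hγ]
  let Φ : a'.SpecialOrbit ≃ a.SpecialOrbit := φ.subtypeEquiv fun o => by
    obtain ⟨γ, e', he', hp⟩ := hex o
    have hst := mem_stab_iff_of_intertwine he' o.out
    rw [← hp, not_iff_not, Subgroup.eq_bot_iff_forall, Subgroup.eq_bot_iff_forall]
    constructor
    · intro h x hx
      have := h _ ((hst x).1 hx)
      simpa using this
    · intro h x hx
      have := h (γ⁻¹ * x * γ) ((hst _).2 (by simpa [mul_assoc] using hx))
      simpa [mul_assoc, inv_mul_eq_one] using this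
  symm
  refine finsum_eq_of_bijective Φ Φ.bijective fun o => ?_
  obtain ⟨γ, e', he', hp⟩ := hex o.1
  exact (Burn1.of_eq_of_rel (pointSymbol_rel ha ha' he' hp (Φ o).2 o.2)).symm

lemma Birational.genericSymbol_rel [CharZero k] (ha : a.GenericallyFree)
    (ha' : a'.GenericallyFree) (h : a.Birational a') :
    (a.genericSymbol ha).Rel (a'.genericSymbol ha') := by
  obtain ⟨e, he⟩ := h
  refine ⟨1, fun x => by simp [genericSymbol], fun x => by simp [genericSymbol],
    ⟨e, fun y x => ?_⟩, List.Perm.of_eq rfl⟩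
  refine (he y x).trans ?_
  change a'.pull y (e x) = a'.pull (1 * y * 1⁻¹) (e x)
  rw [one_mul, inv_one, mul_one]

/-- Following `e` by the action of `γ⁻¹` undoes the conjugation. -/
lemma birational_of_genericSymbol_rel [CharZero k] {ha : a.GenericallyFree}
    {ha' : a'.GenericallyFree} (h : (a.genericSymbol ha).Rel (a'.genericSymbol ha')) :
    a.Birational a' := by
  obtain ⟨γ, hH, hY, ⟨e, he⟩, -⟩ := h
  obtain ⟨e, he⟩ : ∃ e : RatFunc k ≃ₐ[k] RatFunc k, ∀ (g : G) (f : RatFunc k),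
    e (a.pull g f) = a'.pull (γ * g * γ⁻¹) (e f) := ⟨e, fun g f => he ⟨g, trivial⟩ f⟩
  refine ⟨e.trans (a'.pull γ⁻¹), fun g f => ?_⟩
  rw [AlgEquiv.trans_apply, AlgEquiv.trans_apply, he, ← pull_mul_apply, ← pull_mul_apply,
    ← mul_assoc, inv_mul_cancel_left]

/-- Related symbols have equally many characters, so point symbols do not contribute to the
multiplicity of the generic one. -/
lemma birational_of_burnClass_eq [CharZero k] [Finite G] {ha : a.GenericallyFree}
    {ha' : a'.GenericallyFree} (h : a.burnClass ha = a'.burnClass ha') : a.Birational a' := by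
  have hno : ∀ (b : P1Action k G) (hb : b.GenericallyFree) (o : b.SpecialOrbit),
      ¬ (a.genericSymbol ha).Rel (b.pointSymbol hb o.1.out o.2) := by
    rintro b hb o ⟨_, _, _, _, hβ⟩
    exact Nat.one_ne_zero hβ.length_eq
  have h1 := congrArg (Burn1.mult (a.genericSymbol ha)) h
  rw [burnClass, burnClass, map_add, map_add, pointClass, pointClass,
    Burn1.mult_sum_eq_zero _ _ (hno a ha), Burn1.mult_sum_eq_zero _ _ (hno a' ha'),
    Burn1.mult_of, Burn1.mult_of, if_pos (BurnSymbol.Rel.refl _)] at h1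
  by_contra hnb
  rw [if_neg fun h => hnb (birational_of_genericSymbol_rel h)] at h1
  simp at h1

/-- Representatives in `SL₂(k)` of a generically free action. -/
lemma exists_projLift [IsAlgClosed k] [CharZero k] (a : P1Action k G) (ha : a.GenericallyFree) :
    ∃ L : ProjLift k G, ∀ g, a.pull g RatFunc.X = moebius (L.M g) := by
  have hex : ∀ g, ∃ A : Matrix (Fin 2) (Fin 2) k, A.det = 1 ∧ a.pull g RatFunc.X = moebius A := by
    intro g
    obtain ⟨A, hA, h⟩ := exists_moebius (a.pull g)
    -- Scaling by a square root of the inverse determinant gives determinant one.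
    obtain ⟨z, hz⟩ := IsAlgClosed.exists_pow_nat_eq (A.det)⁻¹ (n := 2) (by norm_num)
    have hz0 : z ≠ 0 := by
      rintro rfl
      have := inv_ne_zero hA
      rw [← hz] at this
      simp at this
    refine ⟨z • A, ?_, by rw [moebius_smul hz0, h]⟩
    rw [Matrix.det_smul, Fintype.card_fin, hz, inv_mul_cancel₀ hA]
  choose M hdet hM using hex
  have hdet0 : ∀ g, (M g).det ≠ 0 := fun g => by simp [hdet]
  refine ⟨⟨M, hdet, fun g h => ?_, fun g hg => ?_⟩, hM⟩
  · refine eq_or_eq_neg_of_moebius_eq (hdet _) (by simp [hdet]) ?_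
    rw [← hM, map_mul, mul_apply_X (hdet0 g) (hdet0 h) (hM g) (hM h)]
  · apply ha.pull_injective
    apply algEquiv_ext_X
    rw [hM]
    rcases hg with hg | hg <;> simp [hg, moebius_neg, moebius_one]

lemma birational_of_conjugate {L L' : ProjLift k G} (hL : ∀ g, a.pull g RatFunc.X = moebius (L.M g))
    (hL' : ∀ g, a'.pull g RatFunc.X = moebius (L'.M g)) (h : L.Conjugate L') :
    a.Birational a' := by
  obtain ⟨A, hA, h⟩ := h
  obtain ⟨e, he⟩ := exists_algEquiv_moebius hA
  refine ⟨e, fun g f => ?_⟩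
  have hg : (L.M g).det ≠ 0 := by simp [L.det_eq]
  have hg' : (L'.M g).det ≠ 0 := by simp [L'.det_eq]
  have key : e * a.pull g = a'.pull g * e := by
    apply algEquiv_ext_X
    rw [mul_apply_X hA hg he (hL g), mul_apply_X hg' hA (hL' g) he]
    rcases h g with h | h <;> rw [h]
    rw [moebius_neg]
  exact congrArg (fun σ : RatFunc k ≃ₐ[k] RatFunc k => σ f) key

/-- The contribution of the points determines the action up to equivariant birationality. -/
theorem birational_of_pointClass_eq [IsAlgClosed k] [CharZero k] [Finite G]
    {ha : a.GenericallyFree} {ha' : a'.GenericallyFree}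
    (h : a.pointClass ha = a'.pointClass ha') : a.Birational a' := by
  obtain ⟨L, hL⟩ := a.exists_projLift ha
  obtain ⟨L', hL'⟩ := a'.exists_projLift ha'
  refine birational_of_conjugate hL hL' (L.conjugate_of_trace_sq L' fun g => ?_)
  by_cases hg : g = 1
  · subst hg
    rcases L.map_one with h1 | h1 <;> rcases L'.map_one with h2 | h2 <;> simp [h1, h2]
  obtain ⟨p, hp⟩ := a.exists_mem_stab g
  -- Only chosen representatives of orbits occur in the class, so `g` is replaced by its conjugate
  -- fixing the representative.
  obtain ⟨δ, hδ⟩ : ∃ δ, a.pt (Quotient.mk a.orbitSetoid p).out δ = p :=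
    Quotient.exact (Quotient.out_eq (Quotient.mk a.orbitSetoid p))
  set o := Quotient.mk a.orbitSetoid p
  have hx : δ * g * δ⁻¹ ∈ a.stab o.out := by
    change a.pt o.out (δ * g * δ⁻¹) = o.out
    have hp' : a.pt p g = p := hp
    rw [a.pt_mul, a.pt_mul, hδ, hp', ← hδ, ← a.pt_mul, mul_inv_cancel, a.pt_one]
  have ho : a.stab o.out ≠ ⊥ := by
    intro hbot
    rw [hbot, Subgroup.mem_bot] at hx
    exact hg (by simpa using hx)
  have := a.finite_specialOrbit ha
  obtain ⟨o', γ, hH, -, -, hβ⟩ := Burn1.exists_rel_of_sum_eq _ _ h ⟨o, ho⟩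
  have hb : (a'.tangentChar ha' o'.1.out).comp (conjHom γ hH) = a.tangentChar ha o.out :=
    (List.cons.inj (List.perm_singleton.1 hβ)).1
  have h1 := (a.isTangentChar_tangentChar ha o.out).trace_sq ⟨_, hx⟩ (L.det_eq _) (hL _)
  have h2 := (a'.isTangentChar_tangentChar ha' o'.1.out).trace_sq
    (conjHom γ hH ⟨_, hx⟩) (L'.det_eq _) (hL' _)
  have h3 : a'.tangentChar ha' o'.1.out (conjHom γ hH ⟨_, hx⟩) = a.tangentChar ha o.out ⟨_, hx⟩ :=
    congrArg (fun b => b (⟨_, hx⟩ : a.stab o.out)) hb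
  rw [h3, ← h1] at h2
  -- Both squared traces equal `2 + b + b⁻¹` for the same character value; the conjugations by `δ`
  -- and `γ` do not affect them.
  have h4 : (L'.M (γ * (δ * g * δ⁻¹) * γ⁻¹)).trace ^ 2 = (L.M (δ * g * δ⁻¹)).trace ^ 2 := h2
  rwa [L'.trace_sq_conj, L'.trace_sq_conj, L.trace_sq_conj] at h4

end P1Action

end

end

end EquivBurnside

theorem mainTheorem9 {k : Type*} [Field k] [IsAlgClosed k] [CharZero k]
    {G : Type*} [Group G] [Finite G]
    (a a' : EquivBurnside.P1Action k G) (ha : a.GenericallyFree) (ha' : a'.GenericallyFree) :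
    (a.burnClass ha = a'.burnClass ha' ↔ a.Birational a') ∧
      (a.pointClass ha = a'.pointClass ha' ↔ a.Birational a') := by
  refine ⟨⟨EquivBurnside.P1Action.birational_of_burnClass_eq, fun h => ?_⟩,
    ⟨EquivBurnside.P1Action.birational_of_pointClass_eq, fun h => h.pointClass_eq ha ha'⟩⟩
  rw [EquivBurnside.P1Action.burnClass, EquivBurnside.P1Action.burnClass, h.pointClass_eq ha ha',
    EquivBurnside.Burn1.of_eq_of_rel (h.genericSymbol_rel ha ha')]
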